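/- **Setting.** Hyperbolic numbers are $p=a+bk$ with $a,b\in\mathbb R$, $k^2=1$; with $e_\pm=(1\pm k)/2$ write $p=\lambda_1e_++\lambda_2e_-$, $\lambda_1=a+b$, $\lambda_2=a-b$; as a matrix, $p=U\,\mathrm{diag}(\lambda_1,\lambda_2)\,U$ with $U=\frac1{\sqrt2}\begin{pmatrix}1&1\\1&-1\end{pmatrix}$. More generally $U\,\mathrm{diag}(x,y)\,U$ stands for $xe_++ye_-$, with $x,y$ in two real vector spaces, and hyperbolic numbers act on such elements by $(\lambda_1e_++\lambda_2e_-)(xe_++ye_-)=\lambda_1x\,e_++\lambda_2y\,e_-$. Let $\sigma,\mu$ be positive measures on $\mathbb R$ with $\int\frac{d\sigma(u)}{u^2+1}<\infty$, $\int\frac{d\mu(u)}{u^2+1}<\infty$. Let $P_\sigma$ be the probability measure on the cylinder $\sigma$-algebra of the space $\mathcal S'_{\mathbb R}$ of real tempered distributions with $$\int e^{i\langle s,\omega\rangle}\,dP_\sigma(\omega)=e^{-\frac12\|s\|_\sigma^2},\qquad \|s\|_\sigma^2=\int|\widehat s(u)|^2d\sigma(u),\quad \widehat s(u)=\int e^{-iut}s(t)\,dt,$$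 for all real Schwartz functions $s$; let $\mathcal H(\sigma)$ be the real Hilbert space completion of $\mathcal S_{\mathbb R}$ for $\|\cdot\|_\sigma$, and $Q$ the isometric extension to $\mathcal H(\sigma)$ of the map $s\mapsto\langle s,\cdot\rangle\in L^2(P_\sigma)$. Define $P_\mu$, $\mathcal H(\mu)$ and its map $Q$ likewise. Let $(g_n)_{n\ge0}$, $(g'_n)_{n\ge0}$ be orthonormal bases of $\mathcal H(\sigma)$, $\mathcal H(\mu)$ (assumed separable and infinite-dimensional), and $Z_n=Q_{g_n}\in L^2(P_\sigma)$, $W_n=Q_{g'_n}\in L^2(P_\mu)$. Let $\zeta_n(z)=\frac{(-1)^n}{\pi^{1/4}2^{n/2}\sqrt{n!}}e^{z^2/2}\frac{d^n}{dz^n}e^{-z^2}$ be the normalized Hermite functions, and let $$B_p=\sum_{n=0}^\infty U\begin{pmatrix}\left(\int_0^{\lambda_1}\zeta_n(u)du\right)Z_n&0\\0&\left(\int_0^{\lambda_2}\zeta_n(u)du\right)W_n\end{pmatrix}U\ \in\ L^2(P_\sigma)e_+\oplus L^2(P_\mu)e_-$$ be the hyperbolic Brownian motion. For finitely supported $\alpha=(\alpha_0,\alpha_1,\dots)\in\mathbb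 N_0^{\mathbb N_0}$ put $\alpha!=\prod_n\alpha_n!$, $(2\mathbb N)^{\alpha}=\prod_{n\ge0}(2(n+1))^{\alpha_n}$ and $H_\alpha=\prod_nh_{\alpha_n}(Z_n)$ (respectively, in the $e_-$ component, $\prod_nh_{\alpha_n}(W_n)$), $h_k$ being the probabilists' Hermite polynomials. For $k\in\mathbb N_0$ let $\mathcal G_k$, $\mathcal H_k$ be the spaces of formal series $\sum_\alpha c_\alpha H_\alpha$ (with $c_\alpha\in\mathbb R$) with finite norms $$\Big(\sum_\alpha(\alpha!)^2c_\alpha^2(2\mathbb N)^{k\alpha}\Big)^{1/2},\qquad \|c\|_{-k}=\Big(\sum_\alpha c_\alpha^2(2\mathbb N)^{-k\alpha}\Big)^{1/2};$$ $\mathcal H_k$ with the norm $\|\cdot\|_{-k}$ is also denoted $\mathcal H_{-k}$. Let $\mathcal K=\bigcap_k\mathcal G_k$, with the topology given by all the norms of the $\mathcal G_k$, and $\mathcal K'=\bigcup_k\mathcal H_k$, with the strong topology (uniform convergence on bounded subsets of $\mathcal K$) for the pairing $\langle c,f\rangle=\sum_\alpha\alpha!\,c_\alpha f_\alpha$. A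 square integrable random variable $f$ is identified with its expansion, $c_\alpha=E[fH_\alpha]/\alpha!$. Distributions with hyperbolic values are the elements of $\mathcal K'e_+\oplus\mathcal K'e_-$, with the product topology. **Theorem.** The series defining $B_p$ converges in $L^2(P_\sigma)e_+\oplus L^2(P_\mu)e_-$ for every hyperbolic $p$, and $B_p\in\mathcal K'e_+\oplus\mathcal K'e_-$. For every hyperbolic number $p=\lambda_1e_++\lambda_2e_-$ the formal (coefficientwise) sum $$N_p=\sum_{n=0}^\infty U\begin{pmatrix}\zeta_n(\lambda_1)Z_n&0\\0&\zeta_n(\lambda_2)W_n\end{pmatrix}U$$ belongs to $\mathcal K'e_+\oplus\mathcal K'e_-$, both of its components are in $\mathcal H_{-2}$, and the series converges to $N_p$ in the strong topology of $\mathcal K'e_+\oplus\mathcal K'e_-$. Moreover $$\lim_{\substack{h\to0\\ h^{-1}\text{ exists}}}\frac{B_{p+h}-B_p}{h}=N_p$$ over invertible hyperbolic numbers $h$, in the strong topology of $\mathcal K'e_+\oplus\mathcal K'e_-$; and for every invertible $h$ both components of $\frac{B_{p+h}-B_p}{h}-N_p$ are in $\mathcal H_{-3}$, with $\|\cdot\|_{-3}$-norms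 tending to $0$ as $h\to0$. -/

import Mathlib

open MeasureTheory ProbabilityTheory Filter Topology
open scoped SchwartzMap NNReal ENNReal Nat

noncomputable section

namespace HypNoise

/-! ### Hyperbolic numbers -/

/-- The hyperbolic numbers `a + b k`, `k ^ 2 = 1`, with `a = p.re`, `b = p.im`. -/
abbrev Hyp : Type := QuadraticAlgebra ℝ 1 0

/-- The first idempotent coordinate (eigenvalue) `λ₁ = a + b` of `p = λ₁ e₊ + λ₂ e₋`. -/
def Hyp.lam1 (p : Hyp) : ℝ := p.re + p.im

/-- The second idempotent coordinate (eigenvalue) `λ₂ = a - b` of `p = λ₁ e₊ + λ₂ e₋`. -/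
def Hyp.lam2 (p : Hyp) : ℝ := p.re - p.im

/-- The Euclidean norm `‖a + b k‖ = √(a² + b²)` on the hyperbolic numbers. -/
def Hyp.euclNorm (p : Hyp) : ℝ := √(p.re ^ 2 + p.im ^ 2)

/-- The orthogonal symmetric matrix diagonalizing every hyperbolic number. -/
def U : Matrix (Fin 2) (Fin 2) ℝ := (√2)⁻¹ • !![1, 1; 1, -1]

/-- The matrix form of a hyperbolic number, `p = U diag(λ₁, λ₂) U`. -/
theorem Hyp.matrix_eq (p : Hyp) :
    !![p.re, p.im; p.im, p.re] = U * Matrix.diagonal ![p.lam1, p.lam2] * U := by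
  have h2 : (√2)⁻¹ * (√2)⁻¹ = (1 / 2 : ℝ) := by
    rw [← mul_inv, Real.mul_self_sqrt (by norm_num)]; norm_num
  have hU : U * Matrix.diagonal ![p.lam1, p.lam2] * U =
      ((√2)⁻¹ * (√2)⁻¹) • !![p.lam1 + p.lam2, p.lam1 - p.lam2;
        p.lam1 - p.lam2, p.lam1 + p.lam2] := by
    rw [Matrix.diagonal_fin_two]
    simp only [U, Matrix.smul_mul, Matrix.mul_smul, smul_smul, Matrix.mul_fin_two,
      Matrix.cons_val_zero, Matrix.cons_val_one]
    congr 1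
    ext i j
    fin_cases i <;> fin_cases j <;> simp <;> ring
  rw [hU, h2]
  ext i j
  fin_cases i <;> fin_cases j <;> simp [Hyp.lam1, Hyp.lam2] <;> ring

theorem Hyp.lam1_mul (p q : Hyp) : (p * q).lam1 = p.lam1 * q.lam1 := by
  simp [Hyp.lam1]; ring

theorem Hyp.lam2_mul (p q : Hyp) : (p * q).lam2 = p.lam2 * q.lam2 := by
  simp [Hyp.lam2]; ring

/-- `Idem M N` is the space `M e₊ ⊕ N e₋` of all `U diag(x, y) U`, with `x ∈ M` and `y ∈ N`;
the element `U diag(x, y) U = x e₊ + y e₋` is the pair `(x, y)`. -/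
def Idem (M N : Type*) : Type _ := M × N

namespace Idem

variable {M N : Type*}

/-- The element `U diag(x, y) U = x e₊ + y e₋`. -/
def mk (x : M) (y : N) : Idem M N := (x, y)

/-- The coefficient of `e₊`. -/
def plus (z : Idem M N) : M := Prod.fst z

/-- The coefficient of `e₋`. -/
def minus (z : Idem M N) : N := Prod.snd z

instance [AddCommGroup M] [AddCommGroup N] : AddCommGroup (Idem M N) :=
  inferInstanceAs (AddCommGroup (M × N))

instance [TopologicalSpace M] [TopologicalSpace N] : TopologicalSpace (Idem M N) :=
  inferInstanceAs (TopologicalSpace (M × N))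

/-- Hyperbolic numbers act by
`(λ₁ e₊ + λ₂ e₋) (x e₊ + y e₋) = (λ₁ x) e₊ + (λ₂ y) e₋`. -/
instance [AddCommGroup M] [AddCommGroup N] [Module ℝ M] [Module ℝ N] :
    Module Hyp (Idem M N) where
  smul p z := mk (p.lam1 • z.plus) (p.lam2 • z.minus)
  one_smul z := Prod.ext (show (1 : Hyp).lam1 • z.plus = z.plus by
      rw [show (1 : Hyp).lam1 = 1 from add_zero 1, one_smul])
    (show (1 : Hyp).lam2 • z.minus = z.minus by
      rw [show (1 : Hyp).lam2 = 1 from sub_zero 1, one_smul])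
  mul_smul p q z := Prod.ext
    (show (p * q).lam1 • z.plus = p.lam1 • q.lam1 • z.plus by rw [Hyp.lam1_mul, mul_smul])
    (show (p * q).lam2 • z.minus = p.lam2 • q.lam2 • z.minus by rw [Hyp.lam2_mul, mul_smul])
  smul_zero p := Prod.ext (show p.lam1 • (0 : M) = 0 from smul_zero _)
    (show p.lam2 • (0 : N) = 0 from smul_zero _)
  smul_add p z w := Prod.ext
    (show p.lam1 • (z.plus + w.plus) = p.lam1 • z.plus + p.lam1 • w.plus from smul_add _ _ _)
    (show p.lam2 • (z.minus + w.minus) = p.lam2 • z.minus + p.lam2 • w.minus from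
      smul_add _ _ _)
  add_smul p q z := Prod.ext
    (show (p + q).lam1 • z.plus = p.lam1 • z.plus + q.lam1 • z.plus by
      rw [← add_smul]; congr 1; simp [Hyp.lam1]; ring)
    (show (p + q).lam2 • z.minus = p.lam2 • z.minus + q.lam2 • z.minus by
      rw [← add_smul]; congr 1; simp [Hyp.lam2]; ring)
  zero_smul z := Prod.ext (show (0 : Hyp).lam1 • z.plus = 0 by simp [Hyp.lam1])
    (show (0 : Hyp).lam2 • z.minus = 0 by simp [Hyp.lam2])

end Idem

/-! ### The white noise space -/

/-- The space `S'` of real-valued tempered distributions on the line. -/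
def TempDist : Type := 𝓢(ℝ, ℝ) →L[ℝ] ℝ

/-- The duality bracket `⟨s, ω⟩` of a test function and a tempered distribution. -/
def TempDist.pair (s : 𝓢(ℝ, ℝ)) (ω : TempDist) : ℝ :=
  (show 𝓢(ℝ, ℝ) →L[ℝ] ℝ from ω) s

/-- The cylinder sigma-algebra of `S'`. -/
instance : MeasurableSpace TempDist :=
  ⨆ s : 𝓢(ℝ, ℝ), MeasurableSpace.comap (TempDist.pair s) inferInstance

theorem measurable_pair (s : 𝓢(ℝ, ℝ)) : Measurable (TempDist.pair s) :=
  Measurable.of_comap_le (le_iSup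
    (fun s : 𝓢(ℝ, ℝ) => MeasurableSpace.comap (TempDist.pair s) inferInstance) s)

/-- The Fourier transform `ŝ(u) = ∫ e^{-iut} s(t) dt`. -/
def fourierHat (s : 𝓢(ℝ, ℝ)) (u : ℝ) : ℂ :=
  ∫ t : ℝ, Complex.exp (-(Complex.I * u * t)) * (s t : ℂ)

/-- The condition `∫ dσ(u) / (u² + 1) < ∞` on a positive measure on the line. -/
def IsSpectral (σ : Measure ℝ) : Prop :=
  ∫⁻ u : ℝ, ENNReal.ofReal (1 / (u ^ 2 + 1)) ∂σ < ∞

/-- `P` is the white noise probability measure `P_σ` on the cylinder sigma-algebra of `S'`: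
`∫ e^{i⟨s, ω⟩} dP(ω) = exp (-½ ∫ |ŝ(u)|² dσ(u))` for all test functions `s`. -/
def IsWhiteNoiseMeasure (σ : Measure ℝ) (P : Measure TempDist) : Prop :=
  IsProbabilityMeasure P ∧ ∀ s : 𝓢(ℝ, ℝ),
    ∫ ω, Complex.exp (Complex.I * (TempDist.pair s ω : ℂ)) ∂P =
      Complex.exp (-((∫ u, ‖fourierHat s u‖ ^ 2 ∂σ : ℝ) : ℂ) / 2)

theorem fourierHat_eq (s : 𝓢(ℝ, ℝ)) (u : ℝ) :
    fourierHat s u =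
      (FourierTransform.fourier (s.postcompCLM (𝕜 := ℝ) Complex.ofRealCLM) : 𝓢(ℝ, ℂ))
        (u / (2 * Real.pi)) := by
  rw [SchwartzMap.fourier_coe, Real.fourier_real_eq_integral_exp_smul]
  unfold fourierHat
  refine integral_congr_ae (Eventually.of_forall fun t => ?_)
  simp only [SchwartzMap.postcompCLM_apply, Complex.ofRealCLM_apply, smul_eq_mul]
  congr 2
  push_cast
  field_simp

theorem memLp_fourierHat {σ : Measure ℝ} (hσ : IsSpectral σ) (s : 𝓢(ℝ, ℝ)) :
    MemLp (fourierHat s) 2 σ := by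
  set F : 𝓢(ℝ, ℂ) :=
    FourierTransform.fourier (s.postcompCLM (𝕜 := ℝ) Complex.ofRealCLM) with hF
  have hcont : Continuous (fourierHat s) := by
    have : fourierHat s = fun u => F (u / (2 * Real.pi)) := funext (fourierHat_eq s)
    rw [this]; exact F.continuous.comp (by fun_prop)
  rw [memLp_two_iff_integrable_sq_norm hcont.aestronglyMeasurable]
  obtain ⟨C₀, hC₀⟩ := F.decay 0 0
  obtain ⟨C₁, hC₁⟩ := F.decay 1 0
  have hint : Integrable (fun u : ℝ => 1 / (u ^ 2 + 1)) σ := by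
    refine ⟨(by fun_prop : Measurable fun u : ℝ => 1 / (u ^ 2 + 1)).aestronglyMeasurable, ?_⟩
    rw [hasFiniteIntegral_iff_ofReal (Eventually.of_forall fun u => by positivity)]
    exact hσ
  refine (hint.const_mul (C₀ ^ 2 + (2 * Real.pi * C₁) ^ 2)).mono'
    (by fun_prop) (Eventually.of_forall fun u => ?_)
  have h0 := hC₀.2 (u / (2 * Real.pi))
  have h1 := hC₁.2 (u / (2 * Real.pi))
  rw [norm_iteratedFDeriv_zero, ← fourierHat_eq] at h0 h1
  rw [pow_zero, one_mul] at h0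
  rw [pow_one, norm_div, Real.norm_of_nonneg (by positivity : (0 : ℝ) ≤ 2 * Real.pi),
    div_mul_eq_mul_div, div_le_iff₀ (by positivity)] at h1
  have e0 : ‖fourierHat s u‖ ^ 2 ≤ C₀ ^ 2 := by gcongr
  have e1 : (‖u‖ * ‖fourierHat s u‖) ^ 2 ≤ (2 * Real.pi * C₁) ^ 2 := by
    have : C₁ * (2 * Real.pi) = 2 * Real.pi * C₁ := by ring
    rw [← this]; gcongr
  rw [mul_pow, Real.norm_eq_abs, sq_abs] at e1
  rw [Real.norm_of_nonneg (by positivity), mul_one_div, le_div_iff₀ (by positivity)]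
  nlinarith

/-- The map `s ↦ ŝ` from test functions to `L²(σ)`. -/
def fourierL2 {σ : Measure ℝ} (hσ : IsSpectral σ) : 𝓢(ℝ, ℝ) →ₗ[ℝ] Lp ℂ 2 σ where
  toFun s := (memLp_fourierHat hσ s).toLp (fourierHat s)
  map_add' s t := by
    rw [← MemLp.toLp_add]
    congr 1
    ext u
    simp [fourierHat_eq, FourierTransform.fourier_add]
  map_smul' c s := by
    rw [RingHom.id_apply, ← MemLp.toLp_const_smul]
    congr 1
    ext u
    simp only [fourierHat_eq, Pi.smul_apply]
    rw [map_smul, FourierTransform.fourier_smul, smul_apply]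

/-- The real Hilbert space `H(σ)`: the completion of the real test functions for the (semi)norm
`‖s‖_σ² = ∫ |ŝ|² dσ`, realized as the closure of `{ŝ}` in `L²(σ)`. -/
def HSpace {σ : Measure ℝ} (hσ : IsSpectral σ) : Submodule ℝ (Lp ℂ 2 σ) :=
  (LinearMap.range (fourierL2 hσ)).topologicalClosure

/-- A test function as an element of `H(σ)`. -/
def toHSpace {σ : Measure ℝ} (hσ : IsSpectral σ) : 𝓢(ℝ, ℝ) →ₗ[ℝ] HSpace hσ :=
  (fourierL2 hσ).codRestrict (HSpace hσ) fun s =>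
    Submodule.le_topologicalClosure _ (LinearMap.mem_range_self _ s)

theorem denseRange_toHSpace {σ : Measure ℝ} (hσ : IsSpectral σ) :
    DenseRange (toHSpace hσ) := by
  intro x
  have hx : (x : Lp ℂ 2 σ) ∈ closure (Set.range (fourierL2 hσ)) := x.2
  rw [closure_subtype]
  convert hx using 2
  ext y
  constructor
  · rintro ⟨_, ⟨s, rfl⟩, rfl⟩
    exact ⟨s, rfl⟩
  · rintro ⟨s, rfl⟩
    exact ⟨toHSpace hσ s, ⟨s, rfl⟩, rfl⟩

theorem map_pair_eq {σ : Measure ℝ} {P : Measure TempDist} (hP : IsWhiteNoiseMeasure σ P)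
    (s : 𝓢(ℝ, ℝ)) :
    P.map (TempDist.pair s) = gaussianReal 0 (∫ u, ‖fourierHat s u‖ ^ 2 ∂σ).toNNReal := by
  have := hP.1
  have := Measure.isProbabilityMeasure_map (μ := P) (measurable_pair s).aemeasurable
  refine Measure.ext_of_charFun (funext fun t => ?_)
  rw [charFun_gaussianReal, charFun_apply_real,
    integral_map (measurable_pair s).aemeasurable (by fun_prop),
    Real.coe_toNNReal _ (integral_nonneg fun u => by positivity)]
  have h := hP.2 (t • s)
  have e1 : ∀ u, ‖fourierHat (t • s) u‖ ^ 2 = t ^ 2 * ‖fourierHat s u‖ ^ 2 := fun u => by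
    simp only [fourierHat_eq]
    rw [map_smul, FourierTransform.fourier_smul, smul_apply, norm_smul, mul_pow,
      Real.norm_eq_abs, sq_abs]
  simp_rw [e1] at h
  rw [integral_const_mul] at h
  have e2 : ∀ ω, TempDist.pair (t • s) ω = t * TempDist.pair s ω := fun ω =>
    (show 𝓢(ℝ, ℝ) →L[ℝ] ℝ from ω).map_smul t s
  simp_rw [e2] at h
  convert h using 1
  · refine integral_congr_ae (Eventually.of_forall fun ω => ?_)
    simp only []
    congr 1
    push_cast
    ring
  · congr 1
    push_cast
    ring

theorem memLp_pair {σ : Measure ℝ} {P : Measure TempDist} (hP : IsWhiteNoiseMeasure σ P)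
    (s : 𝓢(ℝ, ℝ)) : MemLp (TempDist.pair s) 2 P := by
  have h := memLp_id_gaussianReal (μ := 0) (v := (∫ u, ‖fourierHat s u‖ ^ 2 ∂σ).toNNReal) 2
  rw [← map_pair_eq hP s] at h
  exact (memLp_map_measure_iff h.1 (measurable_pair s).aemeasurable).1 h

/-- The map `s ↦ Q_s`, `Q_s(ω) = ⟨s, ω⟩`, from test functions to `L²(P)`. -/
def pairL2 {σ : Measure ℝ} {P : Measure TempDist} (hP : IsWhiteNoiseMeasure σ P) :
    𝓢(ℝ, ℝ) →ₗ[ℝ] Lp ℝ 2 P where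
  toFun s := (memLp_pair hP s).toLp (TempDist.pair s)
  map_add' s t := by
    rw [← MemLp.toLp_add]
    congr 1
    ext ω
    exact (show 𝓢(ℝ, ℝ) →L[ℝ] ℝ from ω).map_add s t
  map_smul' c s := by
    rw [RingHom.id_apply, ← MemLp.toLp_const_smul]
    congr 1
    ext ω
    exact (show 𝓢(ℝ, ℝ) →L[ℝ] ℝ from ω).map_smul c s

theorem norm_pairL2 {σ : Measure ℝ} {P : Measure TempDist} (hσ : IsSpectral σ)
    (hP : IsWhiteNoiseMeasure σ P) (s : 𝓢(ℝ, ℝ)) : ‖pairL2 hP s‖ = ‖toHSpace hσ s‖ := by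
  have := hP.1
  have hv : 0 ≤ ∫ u, ‖fourierHat s u‖ ^ 2 ∂σ := integral_nonneg fun u => by positivity
  have h1 : ‖pairL2 hP s‖ ^ 2 = ∫ u, ‖fourierHat s u‖ ^ 2 ∂σ := by
    have hm : ∫ x, x ^ 2 ∂(P.map (TempDist.pair s)) = ∫ u, ‖fourierHat s u‖ ^ 2 ∂σ := by
      rw [map_pair_eq hP s]
      have h := variance_id_gaussianReal (μ := 0)
        (v := (∫ u, ‖fourierHat s u‖ ^ 2 ∂σ).toNNReal)
      rw [variance_of_integral_eq_zero aemeasurable_id (by simp [integral_id_gaussianReal])] at h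
      simpa [hv] using h
    rw [← hm, integral_map (measurable_pair s).aemeasurable (by fun_prop),
      ← real_inner_self_eq_norm_sq, L2.inner_def]
    refine integral_congr_ae ?_
    filter_upwards [(memLp_pair hP s).coeFn_toLp] with ω hω
    rw [show (pairL2 hP s) ω = TempDist.pair s ω from hω, real_inner_self_eq_norm_sq,
      Real.norm_eq_abs, sq_abs]
  have h2 : ‖toHSpace hσ s‖ ^ 2 = ∫ u, ‖fourierHat s u‖ ^ 2 ∂σ := by
    rw [show ‖toHSpace hσ s‖ = ‖fourierL2 hσ s‖ from rfl,
      ← real_inner_self_eq_norm_sq, L2.inner_def]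
    refine integral_congr_ae ?_
    filter_upwards [(memLp_fourierHat hσ s).coeFn_toLp] with u hu
    rw [show (fourierL2 hσ s) u = fourierHat s u from hu, real_inner_self_eq_norm_sq]
  exact (sq_eq_sq₀ (norm_nonneg _) (norm_nonneg _)).1 (h1.trans h2.symm)

/-- The isometric extension `f ↦ Q_f` of `s ↦ Q_s` to all of `H(σ)`. -/
def Q {σ : Measure ℝ} {P : Measure TempDist} (hσ : IsSpectral σ)
    (hP : IsWhiteNoiseMeasure σ P) : HSpace hσ →L[ℝ] Lp ℝ 2 P :=
  (pairL2 hP).extendOfNorm (toHSpace hσ)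

theorem Q_toHSpace {σ : Measure ℝ} {P : Measure TempDist} (hσ : IsSpectral σ)
    (hP : IsWhiteNoiseMeasure σ P) (s : 𝓢(ℝ, ℝ)) : Q hσ hP (toHSpace hσ s) = pairL2 hP s :=
  LinearMap.extendOfNorm_eq (denseRange_toHSpace hσ)
    ⟨1, fun s => by rw [one_mul, norm_pairL2 hσ hP s]⟩ s

/-! ### Hermite functions and the hyperbolic Brownian motion -/

/-- The normalized Hermite functions. -/
def zeta (n : ℕ) (x : ℝ) : ℝ :=
  (-1) ^ n / (Real.pi ^ (1 / 4 : ℝ) * 2 ^ ((n : ℝ) / 2) * √(n ! : ℝ)) * Real.exp (x ^ 2 / 2) *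
    iteratedDeriv n (fun z : ℝ => Real.exp (-z ^ 2)) x

section Series

variable {P₁ P₂ : Measure TempDist}

/-- The space `L²(P_ℍ) = L²(P₁) e₊ ⊕ L²(P₂) e₋` of the hyperbolic probability
`P_ℍ = U diag(P₁, P₂) U`. -/
abbrev HypL2 (P₁ P₂ : Measure TempDist) : Type := Idem (Lp ℝ 2 P₁) (Lp ℝ 2 P₂)

/-- The term `U diag((∫₀^λ₁ ζₙ) Zₙ, (∫₀^λ₂ ζₙ) Wₙ) U`. -/
def brownianTerm (Z : ℕ → Lp ℝ 2 P₁) (W : ℕ → Lp ℝ 2 P₂) (p : Hyp) (n : ℕ) : HypL2 P₁ P₂ :=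
  Idem.mk ((∫ u in (0 : ℝ)..p.lam1, zeta n u) • Z n) ((∫ u in (0 : ℝ)..p.lam2, zeta n u) • W n)

/-- The hyperbolic Brownian motion `B_p`, a series in `L²(P_ℍ)`. -/
def hypBrownian (Z : ℕ → Lp ℝ 2 P₁) (W : ℕ → Lp ℝ 2 P₂) (p : Hyp) : HypL2 P₁ P₂ :=
  ∑' n, brownianTerm Z W p n

/-- The term `U diag(ζₙ(λ₁) Zₙ, ζₙ(λ₂) Wₙ) U`. -/
def noiseTerm (Z : ℕ → Lp ℝ 2 P₁) (W : ℕ → Lp ℝ 2 P₂) (p : Hyp) (n : ℕ) : HypL2 P₁ P₂ :=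
  Idem.mk (zeta n p.lam1 • Z n) (zeta n p.lam2 • W n)

end Series

/-! ### The Kondratiev spaces -/

/-- Finitely supported sequences `α = (α₀, α₁, …)` of nonnegative integers. -/
abbrev MultiIdx : Type := ℕ →₀ ℕ

/-- Formal series `∑ c_α H_α` with real coefficients. -/
abbrev FormalSeries : Type := MultiIdx → ℝ

/-- The factorial `α! = ∏ αₙ!`. -/
def multiFact (α : MultiIdx) : ℕ := α.prod fun _ a => a !

/-- The weight `(2ℕ)^α = ∏ₙ (2 (n + 1)) ^ αₙ`, `n = 0, 1, …`. -/
def natWeight (α : MultiIdx) : ℝ≥0 := α.prod fun n a => (2 * ((n : ℝ≥0) + 1)) ^ a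

/-- The chaos random variable `H_α = ∏ₙ h_{αₙ}(Zₙ)`, with `h_k` the probabilists' Hermite
polynomials. -/
def chaosH {P : Measure TempDist} (Z : ℕ → Lp ℝ 2 P) (α : MultiIdx) (ω : TempDist) : ℝ :=
  α.prod fun n a => Polynomial.aeval (Z n ω) (Polynomial.hermite a)

/-- The chaos expansion `∑ c_α H_α`, `c_α = E[f H_α] / α!`, of `f ∈ L²(P)`, which embeds `L²(P)`
in the formal series. -/
def chaosExpansion {P : Measure TempDist} (Z : ℕ → Lp ℝ 2 P) (f : Lp ℝ 2 P) : FormalSeries :=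
  fun α => (∫ ω, f ω * chaosH Z α ω ∂P) / (multiFact α : ℝ)

/-- Formal series with `∑ v_α |c_α|² < ∞`. -/
def weightedL2 (v : MultiIdx → ℝ≥0) : Submodule ℝ FormalSeries where
  carrier := {c | Summable fun α => (v α : ℝ) * c α ^ 2}
  zero_mem' := by
    change Summable fun α => (v α : ℝ) * (0 : ℝ) ^ 2
    simp
  add_mem' {c d} hc hd := by
    change Summable fun α => (v α : ℝ) * (c α + d α) ^ 2
    refine Summable.of_nonneg_of_le (fun α => by positivity) (fun α => ?_)
      ((hc.mul_left 2).add (hd.mul_left 2))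
    have := mul_nonneg (v α).2 (sq_nonneg (c α - d α))
    change 0 ≤ (v α : ℝ) * (c α - d α) ^ 2 at this
    nlinarith
  smul_mem' a c hc := by
    change Summable fun α => (v α : ℝ) * (a * c α) ^ 2
    refine (hc.mul_left (a ^ 2)).congr fun α => ?_
    ring

/-- The isometry `c ↦ (√v_α c_α)` of the weighted space with the norm `(∑ v_α |c_α|²)^{1/2}`
into `ℓ²`. -/
def weightedEmb (v : MultiIdx → ℝ≥0) : weightedL2 v →ₗ[ℝ] lp (fun _ : MultiIdx => ℝ) 2 where
  toFun c := ⟨fun α => √(v α : ℝ) * c.1 α, by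
    have h : Summable fun α => (v α : ℝ) * c.1 α ^ 2 := c.2
    refine memℓp_gen (h.congr fun α => ?_)
    rw [ENNReal.toReal_ofNat, Real.rpow_two, Real.norm_eq_abs, sq_abs, mul_pow,
      Real.sq_sqrt (NNReal.coe_nonneg (v α))]⟩
  map_add' c d := by
    ext α
    exact mul_add _ _ _
  map_smul' a c := by
    ext α
    exact mul_left_comm _ _ _

/-- The weights `(α!)² (2ℕ)^{kα}` of the space `𝒢_k`. -/
def gWeight (k : ℕ) (α : MultiIdx) : ℝ≥0 := (multiFact α : ℝ≥0) ^ 2 * natWeight α ^ k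

/-- The weights `(2ℕ)^{-kα}` of the space `ℋ_k`. -/
def hWeight (k : ℕ) (α : MultiIdx) : ℝ≥0 := (natWeight α ^ k)⁻¹

/-- The space `ℋ_k` (also written `ℋ_{-k}`), of the formal series with
`∑ |c_α|² (2ℕ)^{-kα} < ∞`. -/
def HNeg (k : ℕ) : Submodule ℝ FormalSeries := weightedL2 (hWeight k)

/-- The norm `(∑ |c_α|² (2ℕ)^{-kα})^{1/2}` of `ℋ_k`; it is used on `HNeg k` only. -/
def negNorm (k : ℕ) (c : FormalSeries) : ℝ := √(∑' α, (hWeight k α : ℝ) * c α ^ 2)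

/-- The formal series in `⋂_k 𝒢_k`. -/
def kTestSeries : Submodule ℝ FormalSeries := ⨅ k : ℕ, weightedL2 (gWeight k)

/-- The Kondratiev space `𝒦 = ⋂_k 𝒢_k` of stochastic test functions. -/
def KTest : Type := kTestSeries

instance : AddCommGroup KTest := inferInstanceAs (AddCommGroup kTestSeries)

instance : Module ℝ KTest := inferInstanceAs (Module ℝ kTestSeries)

/-- The formal series of a stochastic test function. -/
def KTest.series : KTest →ₗ[ℝ] FormalSeries := kTestSeries.subtype

theorem KTest.series_mem (f : KTest) (k : ℕ) : f.series ∈ weightedL2 (gWeight k) :=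
  (Submodule.mem_iInf _).1 (show kTestSeries from f).2 k

/-- A stochastic test function `f`, as the point `(α! (2ℕ)^{kα/2} f_α)` of `ℓ²`, whose norm there
is the norm of `f` in `𝒢_k`. -/
def KTest.emb (k : ℕ) : KTest →ₗ[ℝ] lp (fun _ : MultiIdx => ℝ) 2 :=
  weightedEmb (gWeight k) ∘ₗ KTest.series.codRestrict _ fun f => f.series_mem k

/-- The Fréchet topology of `𝒦`, given by the norms of all the spaces `𝒢_k`. -/
instance : TopologicalSpace KTest :=
  ⨅ k : ℕ, TopologicalSpace.induced (KTest.emb k) inferInstance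

theorem hNeg_mono : Monotone HNeg := by
  intro j k hjk c hc
  have hw : ∀ α, 1 ≤ natWeight α := fun α => by
    refine Finset.one_le_prod' fun n _ => one_le_pow₀ ?_
    have : (1 : ℝ≥0) ≤ (n : ℝ≥0) + 1 := le_add_of_nonneg_left zero_le
    exact this.trans (le_mul_of_one_le_left zero_le one_le_two)
  refine Summable.of_nonneg_of_le (fun α => by positivity) (fun α => ?_) hc
  have : hWeight k α ≤ hWeight j α :=
    inv_anti₀ (pow_pos (zero_lt_one.trans_le (hw α)) _) (pow_le_pow_right₀ (hw α) hjk)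
  gcongr

/-- The formal series in `⋃_k ℋ_k`. -/
def kDistSeries : Submodule ℝ FormalSeries := ⨆ k : ℕ, HNeg k

/-- The Kondratiev space `𝒦' = ⋃_k ℋ_k` of stochastic distributions. -/
def KDist : Type := kDistSeries

instance : AddCommGroup KDist := inferInstanceAs (AddCommGroup kDistSeries)

instance : Module ℝ KDist := inferInstanceAs (Module ℝ kDistSeries)

/-- The formal series of a stochastic distribution. -/
def KDist.series : KDist →ₗ[ℝ] FormalSeries := kDistSeries.subtype

theorem mem_kDistSeries {c : FormalSeries} : c ∈ kDistSeries ↔ ∃ k, c ∈ HNeg k :=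
  Submodule.mem_iSup_of_directed _ hNeg_mono.directed_le

theorem KDist.exists_mem (c : KDist) : ∃ k, c.series ∈ HNeg k :=
  mem_kDistSeries.1 (show kDistSeries from c).2

theorem natWeight_pos (α : MultiIdx) : 0 < natWeight α :=
  Finset.prod_pos fun n _ => by positivity

theorem hasSum_pairing {k : ℕ} (c : HNeg k) (f : KTest) :
    HasSum (fun α => (multiFact α : ℝ) * c.1 α * f.series α)
      (inner ℝ (weightedEmb (hWeight k) c) (KTest.emb k f)) := by
  rw [show (fun α => (multiFact α : ℝ) * c.1 α * f.series α) = fun α =>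
      inner ℝ (weightedEmb (hWeight k) c α) (KTest.emb k f α) from funext fun α => ?_]
  · exact lp.hasSum_inner (𝕜 := ℝ) (weightedEmb (hWeight k) c) (KTest.emb k f)
  have e : √(hWeight k α : ℝ) * √(gWeight k α : ℝ) = multiFact α := by
    have hp : (0 : ℝ) < (natWeight α : ℝ) ^ k := pow_pos (natWeight_pos α) k
    rw [← Real.sqrt_mul (NNReal.coe_nonneg (hWeight k α))]
    simp only [hWeight, gWeight]
    push_cast
    rw [mul_left_comm, inv_mul_cancel₀ hp.ne', mul_one, Real.sqrt_sq (Nat.cast_nonneg _)]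
  change _ = (√(gWeight k α : ℝ) * f.series α) * (√(hWeight k α : ℝ) * c.1 α)
  rw [← e]
  ring

theorem KTest.continuous_emb (k : ℕ) : Continuous (KTest.emb k) :=
  continuous_iInf_dom (i := k) continuous_induced_dom

/-- The duality bracket `⟨c, f⟩ = ∑ α! c_α f_α` of `𝒦'` and `𝒦`, extending the inner product
of `L²(P)`, which makes `𝒦'` the dual of `𝒦`. -/
def KDist.toDual : KDist →ₗ[ℝ] StrongDual ℝ KTest where
  toFun c :=
    { toFun := fun f => ∑' α, (multiFact α : ℝ) * c.series α * f.series α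
      map_add' := fun f g => by
        obtain ⟨k, hk⟩ := c.exists_mem
        rw [(hasSum_pairing ⟨_, hk⟩ (f + g)).tsum_eq, (hasSum_pairing ⟨_, hk⟩ f).tsum_eq,
          (hasSum_pairing ⟨_, hk⟩ g).tsum_eq, map_add, inner_add_right]
      map_smul' := fun a f => by
        obtain ⟨k, hk⟩ := c.exists_mem
        rw [(hasSum_pairing ⟨_, hk⟩ (a • f)).tsum_eq, (hasSum_pairing ⟨_, hk⟩ f).tsum_eq,
          map_smul, inner_smul_right, RingHom.id_apply, smul_eq_mul]
      cont := by
        obtain ⟨k, hk⟩ := c.exists_mem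
        have := KTest.continuous_emb k
        simp_rw [fun f => (hasSum_pairing ⟨_, hk⟩ f).tsum_eq]
        fun_prop }
  map_add' c d := by
    ext f
    obtain ⟨j, hj⟩ := c.exists_mem
    obtain ⟨k, hk⟩ := d.exists_mem
    change ∑' α, (multiFact α : ℝ) * (c + d).series α * f.series α =
      (∑' α, (multiFact α : ℝ) * c.series α * f.series α) +
        ∑' α, (multiFact α : ℝ) * d.series α * f.series α
    rw [← (hasSum_pairing ⟨_, hj⟩ f).summable.tsum_add (hasSum_pairing ⟨_, hk⟩ f).summable]
    refine tsum_congr fun α => ?_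
    rw [map_add, Pi.add_apply]
    ring
  map_smul' a c := by
    ext f
    change ∑' α, (multiFact α : ℝ) * (a • c).series α * f.series α =
      a * ∑' α, (multiFact α : ℝ) * c.series α * f.series α
    rw [← tsum_mul_left]
    refine tsum_congr fun α => ?_
    rw [map_smul, Pi.smul_apply, smul_eq_mul]
    ring

/-- The strong topology of `𝒦'`: uniform convergence on the bounded subsets of `𝒦`. -/
instance : TopologicalSpace KDist :=
  TopologicalSpace.induced KDist.toDual inferInstance

/-- The hyperbolic stochastic distributions `𝒦' e₊ ⊕ 𝒦' e₋`. In the first summand `H_α` is built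
from `(Zₙ)`, in the second one from `(Wₙ)`. -/
abbrev HypDist : Type := Idem KDist KDist

section Embedding

variable {P₁ P₂ : Measure TempDist}

/-- `x` is the stochastic distribution defined by `f ∈ L²(P_ℍ)`. -/
def IsDistOf (Z : ℕ → Lp ℝ 2 P₁) (W : ℕ → Lp ℝ 2 P₂) (f : HypL2 P₁ P₂) (x : HypDist) : Prop :=
  x.plus.series = chaosExpansion Z f.plus ∧
    x.minus.series = chaosExpansion W f.minus

/-- The formal series `N_p = ∑ₙ U diag(ζₙ(λ₁) Zₙ, ζₙ(λ₂) Wₙ) U`, summed coefficientwise. -/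
def noiseSeries (Z : ℕ → Lp ℝ 2 P₁) (W : ℕ → Lp ℝ 2 P₂) (p : Hyp) :
    Idem FormalSeries FormalSeries :=
  Idem.mk (fun α => ∑' n, chaosExpansion Z (noiseTerm Z W p n).plus α)
    (fun α => ∑' n, chaosExpansion W (noiseTerm Z W p n).minus α)

end Embedding

/-- The filter `h → 0` over the invertible hyperbolic numbers `h`. -/
def toZeroUnits : Filter Hypˣ := comap (fun h : Hypˣ => Hyp.euclNorm (h : Hyp)) (𝓝 0)

/-- The difference quotient `(B_{p+h} - B_p) / h`, `h` invertible. -/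
def diffQuot (B : Hyp → HypDist) (p : Hyp) (h : Hypˣ) : HypDist :=
  ((h⁻¹ : Hypˣ) : Hyp) • (B (p + h) - B p)

end HypNoise

end

open HypNoise

namespace HypNoise

/-! ### Hermite polynomials and Hermite functions -/

section Hermite

open Polynomial

/-! Every term of both series is a multiple of some `Zₙ` or `Wₙ`, so the problem lives in the first
chaos and reduces to coefficient sequences `b : ℕ → ℝ`. The hyperbolic structure splits over the two
idempotents: each component is a one-dimensional problem in the variable `λ₁` or `λ₂`, and an
invertible `h → 0` means that both eigenvalues tend to `0` through nonzero values.

Two facts on the Hermite functions carry the analysis. They are bounded on each compact interval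
uniformly in `n` (`exists_abs_zeta_le`), and the integrals `∫₀ˣ ζₙ` are square summable
(`summable_sq_zetaInt`). Both follow from the oscillator equation `ζₙ'' = (x² - (2n + 1)) ζₙ`: its
energy is largest at the origin, where explicit Hermite values bound it by a multiple of `√(n + 1)`.

Square summability and the orthonormality of the Gaussian coordinates give the convergence of `B_p`
in `L²`. The weight of `Zₙ` in the norm of index `-k` is `(2 (n + 1))^{-k}`, summable for `k ≥ 2`,
so bounded coefficients put `N_p` in `HNeg 2`. The difference quotient of `∫₀ˣ ζₙ` is an average of
`ζₙ`, hence bounded uniformly in `n`, and it tends to `ζₙ(x)` for each `n`; dominated convergence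
gives the limit in the norm (`tendsto_negNorm_slope_sub`). Norm convergence implies strong
convergence because `ℋ_k`, seen as `ℓ²`, maps continuously to the strong dual of `𝒦`
(`KDist.tendsto_of_negNorm`).

It remains to identify square integrable variables with formal series. The characteristic functional
shows that orthonormal vectors give independent standard Gaussians, so `E[Zₙ H_α]` vanishes unless
`α` is the `n`th unit index (`integral_mul_chaosH`), and `L²` continuity of the coefficients handles
infinite sums (`chaosExpansion_tsum`). -/

theorem derivative_hermite_succ (n : ℕ) :
    derivative (hermite (n + 1)) = (n + 1 : ℕ) * hermite n := by
  induction n with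
  | zero => simp
  | succ n ih =>
    rw [hermite_succ (n + 1), derivative_sub, derivative_mul, derivative_X, one_mul, ih,
      derivative_natCast_mul]
    have h := hermite_succ n
    push_cast
    linear_combination -((n : Polynomial ℤ) + 1) * h

/-- Hermite's differential equation, the source of the oscillator equation: differentiate the
recurrence for the next polynomial and compare with `derivative_hermite_succ`. -/
theorem derivative_derivative_hermite (n : ℕ) :
    derivative (derivative (hermite n)) =
      X * derivative (hermite n) - (n : Polynomial ℤ) * hermite n := by
  have h := derivative_hermite_succ n
  rw [hermite_succ, derivative_sub, derivative_mul, derivative_X] at h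
  push_cast at h
  linear_combination -h

/-- The real function defined by the `n`th probabilists' Hermite polynomial. -/
noncomputable def hermiteFun (n : ℕ) (x : ℝ) : ℝ := aeval x (hermite n)

theorem hermiteFun_zero (x : ℝ) : hermiteFun 0 x = 1 := by simp [hermiteFun]

theorem hermiteFun_one (x : ℝ) : hermiteFun 1 x = x := by simp [hermiteFun]

theorem hasDerivAt_hermiteFun (n : ℕ) (x : ℝ) :
    HasDerivAt (hermiteFun n) (aeval x (derivative (hermite n))) x :=
  (hermite n).hasDerivAt_aeval x

theorem hermiteFun_succ (n : ℕ) (x : ℝ) :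
    hermiteFun (n + 1) x = x * hermiteFun n x - aeval x (derivative (hermite n)) := by
  simp [hermiteFun, hermite_succ]

theorem continuous_hermiteFun (n : ℕ) : Continuous (hermiteFun n) :=
  continuous_iff_continuousAt.2 fun x => (hasDerivAt_hermiteFun n x).continuousAt

/-- The values at `0` satisfy a recurrence of step two, so the induction carries two consecutive
indices. The bound is the decay `n ^ (-1/2)` of the normalized squared values, squared to avoid
roots. -/
theorem sq_hermiteFun_zero_le (n : ℕ) :
    (hermiteFun n 0 ^ 2 / n !) ^ 2 * (n + 1) ≤ 1 ∧
      (hermiteFun (n + 1) 0 ^ 2 / (n + 1)!) ^ 2 * (n + 2) ≤ 1 := by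
  induction n with
  | zero => simp [hermiteFun_zero, hermiteFun_one]
  | succ n ih =>
    refine ⟨by push_cast; linarith [ih.2], ?_⟩
    have h1 : hermiteFun (n + 1 + 1) 0 = -((n + 1) * hermiteFun n 0) := by
      rw [hermiteFun_succ, derivative_hermite_succ]
      simp [hermiteFun]
    have h2 : hermiteFun (n + 1 + 1) 0 ^ 2 / ((n + 1 + 1)! : ℝ) =
        hermiteFun n 0 ^ 2 / n ! * ((n + 1) / (n + 2)) := by
      rw [h1, Nat.factorial_succ, Nat.factorial_succ]
      have := Nat.factorial_ne_zero n
      push_cast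
      field_simp
      ring
    rw [h2]
    -- This amounts to `(n + 1) (n + 3) ≤ (n + 2)²`.
    have h3 : ((n + 1 : ℝ) / (n + 2)) ^ 2 * (n + 3) ≤ n + 1 := by
      rw [div_pow, div_mul_eq_mul_div, div_le_iff₀ (by positivity)]
      nlinarith [Nat.cast_nonneg (α := ℝ) n]
    refine le_trans ?_ ih.1
    rw [mul_pow, mul_assoc]
    push_cast
    gcongr
    linarith

end Hermite

/-! ### Hermite functions: the oscillator equation and the energy bound -/

/-- Substituting `√2 z` in the Gaussian `exp (-y² / 2)` passes to the probabilists' polynomials; the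
factor `√2 ^ n` from the chain rule cancels `2 ^ (n / 2)`, and the two signs `(-1) ^ n` cancel. -/
theorem zeta_eq (n : ℕ) (x : ℝ) :
    zeta n x = (Real.pi ^ (1 / 4 : ℝ) * √(n ! : ℝ))⁻¹ *
      (hermiteFun n (√2 * x) * Real.exp (-x ^ 2 / 2)) := by
  have h1 : (fun z : ℝ => Real.exp (-z ^ 2)) =
      fun z => (fun y => Real.exp (-(y ^ 2 / 2))) (√2 * z) := by
    ext z
    simp only [mul_pow, Real.sq_sqrt (zero_le_two (α := ℝ))]
    congr 1
    ring
  have h2 : (2 : ℝ) ^ ((n : ℝ) / 2) = √2 ^ n := by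
    rw [Real.sqrt_eq_rpow, ← Real.rpow_natCast, ← Real.rpow_mul zero_le_two]
    congr 1
    ring
  have h3 : Real.exp (x ^ 2 / 2) * Real.exp (-((√2 * x) ^ 2 / 2)) = Real.exp (-x ^ 2 / 2) := by
    rw [← Real.exp_add, mul_pow, Real.sq_sqrt zero_le_two]
    congr 1
    ring
  have h4 : ((-1 : ℝ) ^ n) * (-1) ^ n = 1 := by rw [← mul_pow]; simp
  rw [zeta, h1, iteratedDeriv_comp_const_mul
      (f := fun y : ℝ => Real.exp (-(y ^ 2 / 2))) (by fun_prop), h2]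
  beta_reduce
  rw [ iteratedDeriv_eq_iterate,
    Polynomial.deriv_gaussian_eq_hermite_mul_gaussian, ← h3]
  change _ = _ * (Polynomial.aeval (√2 * x) (Polynomial.hermite n) * _)
  have h5 : √(n ! : ℝ) ≠ 0 := by positivity
  generalize (Polynomial.aeval (√2 * x)) (Polynomial.hermite n) = H
  field_simp
  linear_combination H * h4

/-- The derivative of the `n`th Hermite function. -/
noncomputable def zetaDeriv (n : ℕ) (x : ℝ) : ℝ :=
  (Real.pi ^ (1 / 4 : ℝ) * √(n ! : ℝ))⁻¹ *
    ((√2 * Polynomial.aeval (√2 * x) (Polynomial.derivative (Polynomial.hermite n)) -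
      x * hermiteFun n (√2 * x)) * Real.exp (-x ^ 2 / 2))

theorem hasDerivAt_exp_neg_sq (x : ℝ) :
    HasDerivAt (fun x : ℝ => Real.exp (-x ^ 2 / 2)) (-x * Real.exp (-x ^ 2 / 2)) x := by
  have h : HasDerivAt (fun x : ℝ => -x ^ 2 / 2) (-x) x := by
    have := ((hasDerivAt_pow 2 x).neg).div_const 2
    refine this.congr_deriv ?_
    simp only [Nat.cast_ofNat, Nat.add_one_sub_one, pow_one]
    ring
  convert h.exp using 1
  ring

theorem hasDerivAt_zeta (n : ℕ) (x : ℝ) : HasDerivAt (zeta n) (zetaDeriv n x) x := by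
  have hm : HasDerivAt (fun x : ℝ => √2 * x) √2 x := by
    simpa using (hasDerivAt_id x).const_mul √2
  rw [show zeta n = _ from funext (zeta_eq n)]
  refine ((((hasDerivAt_hermiteFun n (√2 * x)).comp x hm).mul
    (hasDerivAt_exp_neg_sq x)).const_mul (Real.pi ^ (1 / 4 : ℝ) * √(n ! : ℝ))⁻¹).congr_deriv ?_
  simp only [zetaDeriv, Function.comp]
  ring

theorem hasDerivAt_zetaDeriv (n : ℕ) (x : ℝ) :
    HasDerivAt (zetaDeriv n) ((x ^ 2 - (2 * n + 1)) * zeta n x) x := by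
  have hm : HasDerivAt (fun x : ℝ => √2 * x) √2 x := by
    simpa using (hasDerivAt_id x).const_mul √2
  have h0 := (hasDerivAt_hermiteFun n (√2 * x)).comp x hm
  have h1 := ((Polynomial.derivative (Polynomial.hermite n)).hasDerivAt_aeval (√2 * x)).comp x hm
  refine ((((h1.const_mul √2).sub ((hasDerivAt_id x).mul h0)).mul
    (hasDerivAt_exp_neg_sq x)).const_mul (Real.pi ^ (1 / 4 : ℝ) * √(n ! : ℝ))⁻¹).congr_deriv ?_
  rw [zeta_eq, derivative_derivative_hermite]
  have h2 : √2 * √2 = (2 : ℝ) := Real.mul_self_sqrt zero_le_two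
  simp only [Function.comp, id, hermiteFun, map_sub, map_mul, Polynomial.aeval_X, map_natCast]
  simp only [Pi.sub_apply, Pi.mul_apply, Function.comp, id, hermiteFun]
  linear_combination -(Real.pi ^ (1 / 4 : ℝ) * √(n ! : ℝ))⁻¹ * Real.exp (-x ^ 2 / 2) *
    (n * Polynomial.aeval (√2 * x) (Polynomial.hermite n) -
      √2 * x * Polynomial.aeval (√2 * x) (Polynomial.derivative (Polynomial.hermite n))) * h2

theorem continuous_zeta (n : ℕ) : Continuous (zeta n) :=
  continuous_iff_continuousAt.2 fun x => (hasDerivAt_zeta n x).continuousAt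

/-- The energy of the oscillator equation `ζₙ'' = (x² - (2n + 1)) ζₙ`. -/
noncomputable def zetaEnergy (n : ℕ) (x : ℝ) : ℝ :=
  zetaDeriv n x ^ 2 + (2 * n + 1 - x ^ 2) * zeta n x ^ 2

theorem hasDerivAt_zetaEnergy (n : ℕ) (x : ℝ) :
    HasDerivAt (zetaEnergy n) (-2 * x * zeta n x ^ 2) x := by
  convert! ((hasDerivAt_zetaDeriv n x).pow 2).add
    (((hasDerivAt_pow 2 x).const_sub (2 * n + 1 : ℝ)).mul ((hasDerivAt_zeta n x).pow 2)) using 1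
  simp
  ring

/-- The derivative `-2 x ζₙ²` of the energy has the sign of `-x`, so the maximum is at the origin.
-/
theorem zetaEnergy_le_zero (n : ℕ) (x : ℝ) : zetaEnergy n x ≤ zetaEnergy n 0 := by
  have hd : ∀ y, deriv (zetaEnergy n) y = -2 * y * zeta n y ^ 2 := fun y =>
    (hasDerivAt_zetaEnergy n y).deriv
  have hdiff : Differentiable ℝ (zetaEnergy n) := fun y =>
    (hasDerivAt_zetaEnergy n y).differentiableAt
  rcases le_total 0 x with hx | hx
  · refine antitoneOn_of_deriv_nonpos (convex_Ici 0) hdiff.continuous.continuousOn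
      hdiff.differentiableOn (fun y hy => ?_) Set.self_mem_Ici hx hx
    rw [interior_Ici] at hy
    rw [hd]
    have : (0 : ℝ) < y := hy
    have := mul_nonneg this.le (sq_nonneg (zeta n y))
    linarith
  · refine monotoneOn_of_deriv_nonneg (convex_Iic 0) hdiff.continuous.continuousOn
      hdiff.differentiableOn (fun y hy => ?_) hx Set.self_mem_Iic hx
    rw [interior_Iic] at hy
    rw [hd]
    have : y < (0 : ℝ) := hy
    have := mul_nonneg (neg_nonneg.2 this.le) (sq_nonneg (zeta n y))
    linarith

theorem sq_hermiteFun_zero_div_le (n : ℕ) :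
    hermiteFun n 0 ^ 2 / n ! * √(n + 1 : ℝ) ≤ 1 := by
  refine (sq_le_one_iff₀ (by positivity)).1 ?_
  rw [mul_pow, Real.sq_sqrt (by positivity)]
  exact (sq_hermiteFun_zero_le n).1

/-- At the origin the potential and the kinetic term are each at most `2 √(n + 1)`: the first by the
bound on the `n`th Hermite value, the second by the bound on the previous one, since the derivative
lowers the degree. -/
theorem zetaEnergy_zero_le (n : ℕ) : zetaEnergy n 0 ≤ 4 * √(n + 1 : ℝ) := by
  have hpi : ((Real.pi ^ (1 / 4 : ℝ))⁻¹) ^ 2 ≤ 1 := by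
    have : (1 : ℝ) ≤ Real.pi ^ (1 / 4 : ℝ) :=
      Real.one_le_rpow (by linarith [Real.pi_gt_three]) (by norm_num)
    exact pow_le_one₀ (by positivity) (inv_le_one_of_one_le₀ this)
  have hs : √(n + 1 : ℝ) * √(n + 1 : ℝ) = n + 1 := Real.mul_self_sqrt (by positivity)
  have hs1 : (1 : ℝ) ≤ √(n + 1 : ℝ) := Real.one_le_sqrt.2 (by simp)
  have h0 : (2 * n + 1) * (hermiteFun n 0 ^ 2 / n !) ≤ 2 * √(n + 1 : ℝ) := by
    have := sq_hermiteFun_zero_div_le n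
    have h : (0 : ℝ) ≤ hermiteFun n 0 ^ 2 / n ! := by positivity
    nlinarith
  have h1 : 2 * (Polynomial.aeval (0 : ℝ) (Polynomial.derivative (Polynomial.hermite n))) ^ 2 / n !
      ≤ 2 * √(n + 1 : ℝ) := by
    cases n with
    | zero => simp
    | succ m =>
      rw [derivative_hermite_succ]
      have := sq_hermiteFun_zero_div_le m
      have hm : √(m + 1 : ℝ) * √(m + 1 : ℝ) = m + 1 := Real.mul_self_sqrt (by positivity)
      have hle : √(m + 1 : ℝ) ≤ √((m + 1 : ℕ) + 1 : ℝ) := Real.sqrt_le_sqrt (by simp)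
      have e : 2 * (Polynomial.aeval (0 : ℝ)
          (((m + 1 : ℕ) : Polynomial ℤ) * Polynomial.hermite m)) ^ 2 / (m + 1)! =
          2 * √(m + 1 : ℝ) * (hermiteFun m 0 ^ 2 / m ! * √(m + 1 : ℝ)) := by
        rw [map_mul, map_natCast, Nat.factorial_succ]
        change 2 * (_ * hermiteFun m 0) ^ 2 / _ = _
        push_cast
        field_simp
        linear_combination -(hermiteFun m 0 ^ 2) * hm
      rw [e]
      calc _ ≤ 2 * √(m + 1 : ℝ) * 1 := by gcongr
        _ ≤ _ := by rw [mul_one]; gcongr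
  have e : zetaEnergy n 0 = ((Real.pi ^ (1 / 4 : ℝ))⁻¹) ^ 2 *
      (2 * (Polynomial.aeval (0 : ℝ) (Polynomial.derivative (Polynomial.hermite n))) ^ 2 / n ! +
        (2 * n + 1) * (hermiteFun n 0 ^ 2 / n !)) := by
    have h2 : √2 ^ 2 = (2 : ℝ) := Real.sq_sqrt zero_le_two
    have h3 : √(n ! : ℝ) ^ 2 = n ! := Real.sq_sqrt (by positivity)
    rw [zetaEnergy, zetaDeriv, zeta_eq]
    simp only [mul_zero, zero_mul, sub_zero, mul_inv, mul_pow, inv_pow, h2, h3]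
    simp
    ring
  rw [e]
  refine (mul_le_of_le_one_left (by positivity) hpi).trans (by linarith)

/-- Near the origin, compared with the turning points `± √(2n + 1)`, the Hermite functions are
of order `n ^ (-1/4)` and their derivatives are of order `n ^ (1/4)`. -/
theorem zeta_sq_le {n : ℕ} {x : ℝ} (hx : x ^ 2 ≤ n) :
    zeta n x ^ 2 ≤ 4 / √(n + 1 : ℝ) ∧ zetaDeriv n x ^ 2 ≤ 4 * √(n + 1 : ℝ) := by
  have h := (zetaEnergy_le_zero n x).trans (zetaEnergy_zero_le n)
  have hs : √(n + 1 : ℝ) * √(n + 1 : ℝ) = n + 1 := Real.mul_self_sqrt (by positivity)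
  have hs0 : 0 < √(n + 1 : ℝ) := by positivity
  unfold zetaEnergy at h
  -- For `x² ≤ n` the potential `2n + 1 - x²` is still at least `n + 1`, so both terms of the energy
  -- are nonnegative.
  have h1 : (n + 1) * zeta n x ^ 2 ≤ (2 * n + 1 - x ^ 2) * zeta n x ^ 2 := by
    gcongr
    linarith
  have h2 : 0 ≤ (n + 1) * zeta n x ^ 2 := by positivity
  refine ⟨?_, by linarith⟩
  rw [le_div_iff₀ hs0]
  have h3 : (zeta n x ^ 2 * √(n + 1 : ℝ)) * √(n + 1 : ℝ) ≤ 4 * √(n + 1 : ℝ) := by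
    rw [mul_assoc, hs]
    linarith [sq_nonneg (zetaDeriv n x)]
  exact le_of_mul_le_mul_right h3 hs0

theorem abs_zeta_le {n : ℕ} {x : ℝ} (hx : x ^ 2 ≤ n) : |zeta n x| ≤ 2 := by
  refine abs_le_of_sq_le_sq ?_ zero_le_two
  refine (zeta_sq_le hx).1.trans ?_
  rw [div_le_iff₀ (by positivity)]
  have hs1 : (1 : ℝ) ≤ √(n + 1 : ℝ) := Real.one_le_sqrt.2 (by simp)
  linarith

/-- The energy bound covers all `n ≥ R²`; compactness of the interval covers the finitely many
others, whose bounds are summed. -/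
theorem exists_abs_zeta_le (R : ℝ) : ∃ C, 0 ≤ C ∧ ∀ n, ∀ x ∈ Set.Icc (-R) R, |zeta n x| ≤ C := by
  obtain ⟨m, hm⟩ := exists_nat_ge (R ^ 2)
  have hb : ∀ n, ∃ C, ∀ x ∈ Set.Icc (-R) R, |zeta n x| ≤ C := fun n =>
    isCompact_Icc.exists_bound_of_continuousOn (continuous_zeta n).continuousOn
  choose C hC using hb
  refine ⟨2 + ∑ n ∈ Finset.range m, |C n|, by positivity, fun n x hx => ?_⟩
  have h0 : 0 ≤ ∑ n ∈ Finset.range m, |C n| := by positivity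
  rcases lt_or_ge n m with hn | hn
  · have := Finset.single_le_sum (fun i _ => abs_nonneg (C i)) (Finset.mem_range.2 hn)
    linarith [hC n x hx, le_abs_self (C n)]
  · have hx2 : x ^ 2 ≤ R ^ 2 := sq_le_sq' hx.1 hx.2
    have hmn : (m : ℝ) ≤ n := Nat.cast_le.2 hn
    linarith [abs_zeta_le (n := n) (hx2.trans (hm.trans hmn))]

/-! ### Integrals of the Hermite functions -/

/-- The coefficients `∫₀ˣ ζₙ` of the Brownian motion. -/
noncomputable def zetaInt (n : ℕ) (x : ℝ) : ℝ := ∫ u in (0 : ℝ)..x, zeta n u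

theorem zetaInt_sub (n : ℕ) (x y : ℝ) : zetaInt n y - zetaInt n x = ∫ u in x..y, zeta n u :=
  intervalIntegral.integral_interval_sub_left ((continuous_zeta n).intervalIntegrable _ _)
    ((continuous_zeta n).intervalIntegrable _ _)

theorem hasDerivAt_zetaInt (n : ℕ) (x : ℝ) : HasDerivAt (zetaInt n) (zeta n x) x :=
  (continuous_zeta n).integral_hasStrictDerivAt 0 x |>.hasDerivAt

/-- The oscillator equation integrated from `0` to `x`; dividing by `2n + 1` gains a power of `n`
over the bound for `ζₙ'`. -/
theorem zetaInt_eq (n : ℕ) (x : ℝ) :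
    (2 * n + 1) * zetaInt n x =
      zetaDeriv n 0 - zetaDeriv n x + ∫ u in (0 : ℝ)..x, u ^ 2 * zeta n u := by
  have hc := continuous_zeta n
  have h := intervalIntegral.integral_eq_sub_of_hasDerivAt (a := 0) (b := x)
    (fun u _ => hasDerivAt_zetaDeriv n u)
    ((by fun_prop : Continuous fun u => (u ^ 2 - (2 * n + 1)) * zeta n u).intervalIntegrable _ _)
  simp_rw [sub_mul] at h
  rw [intervalIntegral.integral_sub
    ((by fun_prop : Continuous fun u => u ^ 2 * zeta n u).intervalIntegrable _ _)
    ((by fun_prop : Continuous fun u => (2 * n + 1) * zeta n u).intervalIntegrable _ _),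
    intervalIntegral.integral_const_mul] at h
  unfold zetaInt
  linarith

/-- In `zetaInt_eq` the derivatives are of order `n ^ (1/4)` and the last integral is bounded, so
the coefficients are of order `n ^ (-3/4)` and their squares of order `n ^ (-3/2)`. -/
theorem summable_sq_zetaInt (x : ℝ) : Summable fun n => zetaInt n x ^ 2 := by
  obtain ⟨C, hC0, hC⟩ := exists_abs_zeta_le |x|
  obtain ⟨m, hm⟩ := exists_nat_ge (x ^ 2)
  have hsum : Summable fun n : ℕ => (4 + |x| ^ 3 * C) ^ 2 * ((n + 1 : ℕ) : ℝ) ^ (-(3 / 2) : ℝ) :=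
    ((summable_nat_add_iff 1).2 (Real.summable_nat_rpow.2 (by norm_num))).mul_left _
  refine Summable.of_norm_bounded_eventually_nat hsum ?_
  filter_upwards [eventually_ge_atTop m] with n hn
  have hxn : x ^ 2 ≤ n := hm.trans (Nat.cast_le.2 hn)
  -- With `s = (n + 1) ^ (1/4)` all the fractional powers become integer powers of `s`.
  set s := √√(n + 1 : ℝ) with hs
  have hs2 : s ^ 2 = √(n + 1 : ℝ) := Real.sq_sqrt (by positivity)
  have hs4 : s ^ 4 = n + 1 := by
    rw [show s ^ 4 = (s ^ 2) ^ 2 by ring, hs2, Real.sq_sqrt (by positivity)]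
  have hs1 : 1 ≤ s := Real.one_le_sqrt.2 (Real.one_le_sqrt.2 (by simp))
  have hd : ∀ y : ℝ, y ^ 2 ≤ n → |zetaDeriv n y| ≤ 2 * s := fun y hy => by
    refine abs_le_of_sq_le_sq ?_ (by positivity)
    rw [mul_pow, hs2]
    linarith [(zeta_sq_le hy).2]
  have hi : |∫ u in (0 : ℝ)..x, u ^ 2 * zeta n u| ≤ |x| ^ 3 * C := by
    have := intervalIntegral.norm_integral_le_of_norm_le_const (a := 0) (b := x)
      (f := fun u => u ^ 2 * zeta n u) (C := |x| ^ 2 * C) fun u hu => by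
        have hu' : |u| ≤ |x| := by
          simpa using Set.abs_sub_left_of_mem_uIcc (Set.uIoc_subset_uIcc hu)
        rw [norm_mul, norm_pow, Real.norm_eq_abs, Real.norm_eq_abs]
        gcongr
        exact hC n u (abs_le.1 hu')
    rw [Real.norm_eq_abs, sub_zero] at this
    linarith
  have h := zetaInt_eq n x
  have h1 : s ^ 4 * |zetaInt n x| ≤ (4 + |x| ^ 3 * C) * s := by
    calc s ^ 4 * |zetaInt n x| ≤ |(2 * n + 1) * zetaInt n x| := by
          rw [abs_mul, abs_of_nonneg (by positivity : (0 : ℝ) ≤ 2 * n + 1), hs4]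
          gcongr
          linarith [Nat.cast_nonneg (α := ℝ) n]
      _ ≤ 2 * s + 2 * s + |x| ^ 3 * C := by
          rw [h]
          refine (abs_add_le _ _).trans (add_le_add ((abs_sub _ _).trans (add_le_add ?_ ?_)) hi)
          · exact hd 0 (by simp)
          · exact hd x hxn
      _ ≤ _ := by
          have : 0 ≤ |x| ^ 3 * C := by positivity
          nlinarith
  have h2 : s ^ 3 * |zetaInt n x| ≤ 4 + |x| ^ 3 * C := by
    refine le_of_mul_le_mul_right ?_ (zero_lt_one.trans_le hs1)
    calc _ = s ^ 4 * |zetaInt n x| := by ring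
      _ ≤ _ := h1
  have h3 : ((n + 1 : ℕ) : ℝ) ^ (-(3 / 2) : ℝ) = (s ^ 6)⁻¹ := by
    rw [Real.rpow_neg (by positivity)]
    congr 1
    push_cast
    rw [← hs4, ← Real.rpow_natCast, ← Real.rpow_mul (by positivity), ← Real.rpow_natCast]
    norm_num
  rw [h3, Real.norm_of_nonneg (by positivity), ← div_eq_mul_inv, le_div_iff₀ (by positivity)]
  calc zetaInt n x ^ 2 * s ^ 6 = (s ^ 3 * |zetaInt n x|) ^ 2 := by
        rw [mul_pow, sq_abs]; ring
    _ ≤ _ := by gcongr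

/-! ### Gaussian moments of the Hermite polynomials -/

/-- For a monomial of degree `n`, Hölder's inequality with `n` factors in `L^{np}`. -/
theorem memLp_aeval_gaussianReal (q : Polynomial ℤ) {p : ℝ≥0∞} (hp : p ≠ ∞) :
    MemLp (fun x : ℝ => Polynomial.aeval x q) p (gaussianReal 0 1) := by
  have hpow : ∀ n : ℕ, MemLp (fun x : ℝ => x ^ n) p (gaussianReal 0 1) := fun n => by
    have h := MemLp.prod' (s := Finset.range n) (f := fun _ => id) (p := fun _ => n * p)
      (μ := gaussianReal 0 1) fun i _ =>
        memLp_id_gaussianReal' (μ := 0) (v := 1) _ (ENNReal.mul_ne_top (by simp) hp)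
    rcases eq_or_ne n 0 with rfl | hn
    · simpa using memLp_const (1 : ℝ)
    · have hn' : (n : ℝ≥0∞) ≠ 0 := by exact_mod_cast hn
      simpa [ENNReal.mul_inv (Or.inl hn') (Or.inl (ENNReal.natCast_ne_top n)), ← mul_assoc,
        ENNReal.mul_inv_cancel hn' (ENNReal.natCast_ne_top n)] using h
  simp only [Polynomial.aeval_eq_sum_range, zsmul_eq_mul]
  exact memLp_finsetSum _ fun i _ => (hpow i).const_mul _

/-- Gaussian integration by parts: against the density, the integrand is minus the derivative of the
density times `q`. -/
theorem integral_aeval_X_mul_sub_derivative (q : Polynomial ℤ) :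
    ∫ x : ℝ, Polynomial.aeval x (Polynomial.X * q - Polynomial.derivative q)
      ∂(gaussianReal 0 1) = 0 := by
  have hint : ∀ r : Polynomial ℤ,
      Integrable fun x : ℝ => gaussianPDFReal 0 1 x * Polynomial.aeval x r := fun r => by
    have h := (memLp_aeval_gaussianReal r ENNReal.one_ne_top).integrable le_rfl
    rw [gaussianReal_of_var_ne_zero 0 one_ne_zero,
      integrable_withDensity_iff_integrable_smul' (measurable_gaussianPDF 0 1)
        (ae_of_all _ fun _ => gaussianPDF_lt_top)] at h
    simpa [toReal_gaussianPDF] using h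
  have hd : ∀ x, HasDerivAt (gaussianPDFReal 0 1) (-x * gaussianPDFReal 0 1 x) x := fun x => by
    have h := (hasDerivAt_exp_neg_sq x).const_mul (√(2 * Real.pi * (1 : ℝ≥0)))⁻¹
    convert! h using 1
    · ext y
      simp [gaussianPDFReal]
    · simp [gaussianPDFReal]
      ring
  rw [integral_gaussianReal_eq_integral_smul one_ne_zero]
  simp only [smul_eq_mul]
  rw [← neg_eq_zero, ← integral_neg]
  refine integral_eq_zero_of_hasDerivAt_of_integrable
    (f := fun x => gaussianPDFReal 0 1 x * Polynomial.aeval x q) (fun x => ?_)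
    (hint _).neg (hint q)
  refine ((hd x).mul (q.hasDerivAt_aeval x)).congr_deriv ?_
  simp only [map_sub, map_mul, Polynomial.aeval_X]
  ring

theorem integral_hermiteFun (n : ℕ) :
    ∫ x, hermiteFun n x ∂(gaussianReal 0 1) = if n = 0 then 1 else 0 := by
  cases n with
  | zero => simp [hermiteFun_zero]
  | succ n =>
    have h := integral_aeval_X_mul_sub_derivative (Polynomial.hermite n)
    rw [← Polynomial.hermite_succ] at h
    simpa [hermiteFun] using h

theorem integral_mul_hermiteFun (n : ℕ) :
    ∫ x, x * hermiteFun n x ∂(gaussianReal 0 1) = if n = 1 then 1 else 0 := by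
  have hint : ∀ m, Integrable (hermiteFun m) (gaussianReal 0 1) := fun m =>
    (memLp_aeval_gaussianReal (Polynomial.hermite m) ENNReal.one_ne_top).integrable le_rfl
  cases n with
  | zero => simp [hermiteFun_zero, integral_id_gaussianReal]
  | succ n =>
    -- By the three-term recurrence, only the constant polynomial contributes to the integral.
    have e : ∀ x, x * hermiteFun (n + 1) x = hermiteFun (n + 1 + 1) x +
        (n + 1) * hermiteFun n x := fun x => by
      rw [hermiteFun_succ (n + 1), derivative_hermite_succ, map_mul, map_natCast]
      simp [hermiteFun]
    simp_rw [e]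
    rw [integral_add (hint _) ((hint _).const_mul _), integral_const_mul,
      integral_hermiteFun, integral_hermiteFun]
    by_cases hn : n = 0 <;> simp [hn]

/-! ### The chaos expansion of the Gaussian coordinates -/

section Chaos

variable {σ : Measure ℝ} {P : Measure TempDist}

theorem norm_Q (hσ : IsSpectral σ) (hP : IsWhiteNoiseMeasure σ P) (f : HSpace hσ) :
    ‖Q hσ hP f‖ = ‖f‖ := by
  refine (denseRange_toHSpace hσ).induction_on f
    (isClosed_eq (by fun_prop) (by fun_prop)) fun s => ?_
  rw [Q_toHSpace, norm_pairL2 hσ hP s]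

/-- The map `f ↦ Q_f` as an isometry. -/
noncomputable def QIsometry (hσ : IsSpectral σ) (hP : IsWhiteNoiseMeasure σ P) :
    HSpace hσ →ₗᵢ[ℝ] Lp ℝ 2 P :=
  ⟨(Q hσ hP).toLinearMap, norm_Q hσ hP⟩

/-- The map is 1-Lipschitz, since `|e^{ia} - e^{ib}| ≤ |a - b|` and the `L¹` norm is at most the
`L²` norm. This carries the characteristic functional from test functions to all of `H(σ)`. -/
theorem continuous_integral_exp [IsProbabilityMeasure P] :
    Continuous fun f : Lp ℝ 2 P => ∫ ω, Complex.exp (Complex.I * (f ω : ℂ)) ∂P := by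
  have hi : ∀ f : Lp ℝ 2 P, Integrable (fun ω => Complex.exp (Complex.I * (f ω : ℂ))) P :=
    fun f => by
      refine Integrable.of_bound (C := 1) ?_ (ae_of_all _ fun ω => ?_)
      · have := Lp.aestronglyMeasurable f
        exact (by fun_prop : Continuous fun x : ℝ =>
          Complex.exp (Complex.I * (x : ℂ))).comp_aestronglyMeasurable this
      · rw [Complex.norm_exp_I_mul_ofReal]
  refine LipschitzWith.continuous (K := 1) (LipschitzWith.of_dist_le_mul fun f g => ?_)
  rw [dist_eq_norm, dist_eq_norm, ← integral_sub (hi f) (hi g), NNReal.coe_one, one_mul]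
  have h1 : Integrable (fun ω => ‖(f - g) ω‖) P :=
    ((Lp.memLp (f - g)).integrable (by norm_num)).norm
  calc _ ≤ ∫ ω, ‖(f - g) ω‖ ∂P := by
        refine norm_integral_le_of_norm_le h1 ?_
        filter_upwards [Lp.coeFn_sub f g] with ω hω
        rw [hω, Pi.sub_apply]
        have e : Complex.exp (Complex.I * (f ω : ℂ)) - Complex.exp (Complex.I * (g ω : ℂ)) =
            Complex.exp (Complex.I * (g ω : ℂ)) *
              (Complex.exp (Complex.I * ((f ω - g ω : ℝ) : ℂ)) - 1) := by
          rw [mul_sub, ← Complex.exp_add, mul_one]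
          congr 2
          push_cast
          ring
        rw [e, norm_mul, Complex.norm_exp_I_mul_ofReal, one_mul]
        exact Real.norm_exp_I_mul_ofReal_sub_one_le
    _ ≤ ‖f - g‖ := by
        have h2 := eLpNorm_le_eLpNorm_of_exponent_le (p := 1) (q := 2) (μ := P)
          (by norm_num) (Lp.aestronglyMeasurable (f - g))
        rw [eLpNorm_one_eq_lintegral_enorm] at h2
        rw [integral_norm_eq_lintegral_enorm (Lp.aestronglyMeasurable (f - g)), Lp.norm_def]
        exact ENNReal.toReal_mono (Lp.eLpNorm_ne_top _) h2

theorem integral_exp_Q (hσ : IsSpectral σ) (hP : IsWhiteNoiseMeasure σ P) (f : HSpace hσ) :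
    ∫ ω, Complex.exp (Complex.I * (Q hσ hP f ω : ℂ)) ∂P =
      Complex.exp (-((‖f‖ ^ 2 : ℝ) : ℂ) / 2) := by
  have := hP.1
  refine (denseRange_toHSpace hσ).induction_on f (isClosed_eq
    (continuous_integral_exp.comp (Q hσ hP).continuous) (by fun_prop)) fun s => ?_
  have h2 : ‖toHSpace hσ s‖ ^ 2 = ∫ u, ‖fourierHat s u‖ ^ 2 ∂σ := by
    rw [show ‖toHSpace hσ s‖ = ‖fourierL2 hσ s‖ from rfl,
      ← real_inner_self_eq_norm_sq, L2.inner_def]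
    refine integral_congr_ae ?_
    filter_upwards [(memLp_fourierHat hσ s).coeFn_toLp] with u hu
    rw [show (fourierL2 hσ s) u = fourierHat s u from hu, real_inner_self_eq_norm_sq]
  rw [Q_toHSpace, h2, ← hP.2 s]
  refine integral_congr_ae ?_
  filter_upwards [(memLp_pair hP s).coeFn_toLp] with ω hω
  rw [show (pairL2 hP s) ω = TempDist.pair s ω from hω]

theorem map_Q_eq (hσ : IsSpectral σ) (hP : IsWhiteNoiseMeasure σ P) {f : HSpace hσ}
    (hf : ‖f‖ = 1) : P.map (Q hσ hP f) = gaussianReal 0 1 := by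
  have := hP.1
  have hm : AEMeasurable (Q hσ hP f) P := (Lp.aestronglyMeasurable _).aemeasurable
  have := Measure.isProbabilityMeasure_map (μ := P) hm
  refine Measure.ext_of_charFun (funext fun t => ?_)
  rw [charFun_gaussianReal, charFun_apply_real, integral_map hm (by fun_prop)]
  have h := integral_exp_Q hσ hP (t • f)
  rw [norm_smul, hf, mul_one, Real.norm_eq_abs, sq_abs, map_smul] at h
  trans ∫ ω, Complex.exp (Complex.I * ((t • Q hσ hP f : Lp ℝ 2 P) ω : ℂ)) ∂P
  · refine integral_congr_ae ?_
    filter_upwards [Lp.coeFn_smul t (Q hσ hP f)] with ω hω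
    rw [hω, Pi.smul_apply, smul_eq_mul]
    congr 1
    push_cast
    ring
  · rw [h]
    congr 1
    push_cast
    ring

/-- The joint characteristic function is the functional at `∑ tᵢ gᵢ`; by orthonormality `‖∑ tᵢ gᵢ‖²
= ∑ tᵢ²`, so it factors. -/
theorem iIndepFun_Q (hσ : IsSpectral σ) (hP : IsWhiteNoiseMeasure σ P) {ι : Type*}
    [Fintype ι]    {g : ι → HSpace hσ} (hg : Orthonormal ℝ g) :
    iIndepFun (fun i => (Q hσ hP (g i) : TempDist → ℝ)) P := by
  have := hP.1
  have hm : ∀ f : HSpace hσ, AEMeasurable (Q hσ hP f) P := fun f =>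
    (Lp.aestronglyMeasurable _).aemeasurable
  refine (iIndepFun_iff_charFun_pi fun i => hm (g i)).2 fun t => ?_
  have hl : ∀ i, charFun (P.map (Q hσ hP (g i)))
      (t i) = Complex.exp (-((t i ^ 2 : ℝ) : ℂ) / 2) := fun i => by
    rw [map_Q_eq hσ hP (hg.1 i), charFun_gaussianReal]
    congr 1
    push_cast
    ring
  have hm2 : AEMeasurable (fun ω => WithLp.toLp 2 fun i => Q hσ hP (g i) ω) P :=
    (WithLp.measurable_toLp 2 _).comp_aemeasurable (aemeasurable_pi_lambda _ fun i => hm (g i))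
  simp_rw [hl]
  rw [← Complex.exp_sum, charFun_apply, integral_map hm2 (by fun_prop)]
  have h := integral_exp_Q hσ hP (∑ i, t i • g i)
  have hn : ‖∑ i, t i • g i‖ ^ 2 = ∑ i, t i ^ 2 := by
    rw [← real_inner_self_eq_norm_sq, hg.inner_sum]
    simp [sq]
  rw [hn] at h
  trans ∫ ω, Complex.exp (Complex.I * (Q hσ hP (∑ i, t i • g i) ω : ℂ)) ∂P
  · refine integral_congr_ae ?_
    have h1 : ∀ᵐ ω ∂P, Q hσ hP (∑ i, t i • g i) ω = ∑ i, t i * Q hσ hP (g i) ω := by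
      rw [map_sum]
      simp_rw [map_smul]
      filter_upwards [Lp.coeFn_finsetSum Finset.univ fun i => t i • Q hσ hP (g i),
        ae_all_iff.2 fun i => Lp.coeFn_smul (t i) (Q hσ hP (g i))] with ω h1 h2
      rw [h1, Finset.sum_apply]
      exact Finset.sum_congr rfl fun i _ => h2 i
    filter_upwards [h1] with ω hω
    rw [hω, mul_comm]
    congr 3
  · rw [h]
    congr 1
    push_cast
    rw [← Finset.sum_neg_distrib, Finset.sum_div]

/-! ### The first chaos and its coefficients -/

/-- The position of the `n`th Gaussian coordinate in the chaos expansion. -/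
noncomputable def unitIdx (n : ℕ) : MultiIdx := Finsupp.single n 1

theorem unitIdx_injective : Function.Injective unitIdx :=
  Finsupp.single_left_injective one_ne_zero

theorem multiFact_unitIdx (n : ℕ) : multiFact (unitIdx n) = 1 := by
  rw [multiFact, unitIdx, Finsupp.prod_single_index] <;> rfl

theorem natWeight_unitIdx (n : ℕ) : natWeight (unitIdx n) = 2 * ((n : ℝ≥0) + 1) := by
  simp [natWeight, unitIdx]

/-- The formal series `∑ₙ bₙ Zₙ` of the first chaos. -/
noncomputable def firstChaos : (ℕ → ℝ) →ₗ[ℝ] FormalSeries :=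
  Function.ExtendByZero.linearMap ℝ unitIdx

theorem firstChaos_unitIdx (b : ℕ → ℝ) (n : ℕ) : firstChaos b (unitIdx n) = b n :=
  unitIdx_injective.extend_apply b (0 : MultiIdx → ℝ) n

theorem firstChaos_of_notMem (b : ℕ → ℝ) {α : MultiIdx} (h : α ∉ Set.range unitIdx) :
    firstChaos b α = 0 :=
  Function.extend_apply' b (0 : MultiIdx → ℝ) α h

theorem firstChaos_single (n : ℕ) (c : ℝ) (α : MultiIdx) :
    firstChaos (Pi.single n c) α = if α = unitIdx n then c else 0 := by
  by_cases h : α ∈ Set.range unitIdx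
  · obtain ⟨m, rfl⟩ := h
    rw [firstChaos_unitIdx, Pi.single_apply]
    simp [unitIdx_injective.eq_iff]
  · rw [firstChaos_of_notMem _ h, if_neg fun h' => h ⟨n, h'.symm⟩]

variable {hσ : IsSpectral σ} {hP : IsWhiteNoiseMeasure σ P} {g : ℕ → HSpace hσ}

theorem memLp_hermiteFun_Q (hg : Orthonormal ℝ g) (n k : ℕ) {p : ℝ≥0∞} (hp : p ≠ ∞) :
    MemLp (fun ω => hermiteFun k (Q hσ hP (g n) ω)) p P := by
  have hm : AEMeasurable (Q hσ hP (g n)) P := (Lp.aestronglyMeasurable _).aemeasurable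
  have h := memLp_aeval_gaussianReal (Polynomial.hermite k) hp
  rw [← map_Q_eq hσ hP (hg.1 n)] at h
  exact (memLp_map_measure_iff h.1 hm).1 h

theorem memLp_chaosH (hg : Orthonormal ℝ g) (α : MultiIdx) :
    MemLp (chaosH (fun n => Q hσ hP (g n)) α) 2 P := by
  have := hP.1
  have h := MemLp.prod' (s := α.support)
    (f := fun n ω => hermiteFun (α n) (Q hσ hP (g n) ω))
    (p := fun _ => α.support.card * 2) (μ := P) fun i _ =>
      memLp_hermiteFun_Q hg i (α i) (by finiteness)
  refine h.mono_exponent ?_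
  -- For empty support the Hölder exponent is `∞`; otherwise it is exactly `2`.
  rcases eq_or_ne α.support.card 0 with hn | hn
  · simp [hn]
  · have hn' : (α.support.card : ℝ≥0∞) ≠ 0 := by exact_mod_cast hn
    simp [ENNReal.mul_inv (Or.inl hn') (Or.inl (ENNReal.natCast_ne_top _)), ← mul_assoc,
      ENNReal.mul_inv_cancel hn' (ENNReal.natCast_ne_top _)]

/-- By independence the expectation is a product over coordinates. The `n`th factor is nonzero only
for `αₙ = 1`, every other one only for `αᵢ = 0`. -/
theorem integral_mul_chaosH (hg : Orthonormal ℝ g) (n : ℕ) (α : MultiIdx) :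
    ∫ ω, Q hσ hP (g n) ω * chaosH (fun n => Q hσ hP (g n)) α ω ∂P =
      if α = unitIdx n then 1 else 0 := by
  classical
  have hm : ∀ i, AEMeasurable (Q hσ hP (g i)) P := fun i =>
    (Lp.aestronglyMeasurable _).aemeasurable
  -- The index `n` is added because the factor `Zₙ` is present even when `αₙ = 0`.
  set s : Finset ℕ := insert n α.support with hs
  have hns : n ∈ s := Finset.mem_insert_self _ _
  let F : ℕ → ℝ → ℝ := fun i x => (if i = n then x else 1) * hermiteFun (α i) x
  have hF : ∀ i, Continuous (F i) := fun i => by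
    have := continuous_hermiteFun (α i)
    refine Continuous.mul ?_ this
    by_cases h : i = n <;> simp only [h, if_true, if_false] <;> fun_prop
  have hFint : ∀ i, ∫ ω, F i (Q hσ hP (g i) ω) ∂P =
      if i = n then (if α i = 1 then 1 else 0) else if α i = 0 then 1 else 0 := fun i => by
    rw [← integral_map (hm i) (hF i).aestronglyMeasurable, map_Q_eq hσ hP (hg.1 i)]
    by_cases h : i = n
    · simp only [F, h, if_true]
      exact integral_mul_hermiteFun _
    · simp only [F, h, if_false, one_mul]
      exact integral_hermiteFun _
  have h1 : ∀ ω, Q hσ hP (g n) ω * chaosH (fun n => Q hσ hP (g n)) α ω =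
      ∏ i : s, F i (Q hσ hP (g i) ω) := fun ω => by
    rw [Finset.prod_coe_sort s fun i => F i (Q hσ hP (g i) ω), Finset.prod_mul_distrib,
      Finset.prod_ite_eq' s n, if_pos hns]
    congr 1
    exact Finsupp.prod_of_support_subset α (Finset.subset_insert _ _) _ fun i _ => by simp
  simp_rw [h1]
  rw [(iIndepFun_Q hσ hP
    (hg.comp ((↑) : s → ℕ) Subtype.val_injective)).integral_fun_prod_comp
      (X := fun i : s => (Q hσ hP (g i) : TempDist → ℝ))
      (f := fun i : s => F i) (fun i => hm i)
      (fun i => (hF i).aestronglyMeasurable)]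
  simp_rw [hFint]
  by_cases hα : α = unitIdx n
  · rw [if_pos hα]
    refine Finset.prod_eq_one fun i _ => ?_
    by_cases hi : (i : ℕ) = n
    · simp [hi, hα, unitIdx]
    · simp [hi, hα, unitIdx]
  · rw [if_neg hα]
    by_cases h1 : α n = 1
    · obtain ⟨m, hm⟩ : ∃ m, α m ≠ unitIdx n m := by
        by_contra! h
        exact hα (Finsupp.ext h)
      have hmn : m ≠ n := by
        rintro rfl
        simp [unitIdx, h1] at hm
      have hm0 : α m ≠ 0 := by simpa [unitIdx, Finsupp.single_apply, hmn.symm] using hm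
      refine Finset.prod_eq_zero (i := ⟨m, Finset.mem_insert_of_mem
        (Finsupp.mem_support_iff.2 hm0)⟩) (Finset.mem_univ _) ?_
      simp [hmn, hm0]
    · exact Finset.prod_eq_zero (i := ⟨n, hns⟩) (Finset.mem_univ _) (by simp [h1])

/-- Since `H_α` is in `L²`, each coefficient is a continuous linear functional, an inner product
with `H_α` divided by `α!`. -/
theorem hasSum_chaosExpansion (hg : Orthonormal ℝ g) {f : ℕ → Lp ℝ 2 P} {F : Lp ℝ 2 P}
    (hf : HasSum f F) (α : MultiIdx) :
    HasSum (fun n => chaosExpansion (fun n => Q hσ hP (g n)) (f n) α)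
      (chaosExpansion (fun n => Q hσ hP (g n)) F α) := by
  set H := (memLp_chaosH (hP := hP) hg α).toLp
  have e : ∀ f : Lp ℝ 2 P, chaosExpansion (fun n => Q hσ hP (g n)) f α =
      inner ℝ H f / (multiFact α : ℝ) := fun f => by
    rw [chaosExpansion, L2.inner_def]
    congr 1
    refine integral_congr_ae ?_
    filter_upwards [(memLp_chaosH (hP := hP) hg α).coeFn_toLp] with ω hω
    rw [hω]
    rfl
  simp_rw [e]
  exact ((innerSL ℝ H).hasSum hf).div_const _

theorem chaosExpansion_smul_Q (hg : Orthonormal ℝ g) (n : ℕ) (c : ℝ) :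
    chaosExpansion (fun n => Q hσ hP (g n)) (c • Q hσ hP (g n)) = firstChaos (Pi.single n c) := by
  ext α
  have h : ∫ ω, (c • Q hσ hP (g n) : Lp ℝ 2 P) ω * chaosH (fun n => Q hσ hP (g n)) α ω ∂P =
      c * if α = unitIdx n then 1 else 0 := by
    rw [← integral_mul_chaosH (hP := hP) hg n α, ← integral_const_mul]
    refine integral_congr_ae ?_
    filter_upwards [Lp.coeFn_smul c (Q hσ hP (g n))] with ω hω
    rw [hω, Pi.smul_apply, smul_eq_mul, mul_assoc]
  rw [chaosExpansion, h, firstChaos_single]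
  split_ifs with h
  · rw [h, multiFact_unitIdx]
    simp
  · simp

theorem hasSum_firstChaos_single (b : ℕ → ℝ) (α : MultiIdx) :
    HasSum (fun n => firstChaos (Pi.single n (b n)) α) (firstChaos b α) := by
  simp_rw [firstChaos_single]
  by_cases h : α ∈ Set.range unitIdx
  · obtain ⟨m, rfl⟩ := h
    rw [firstChaos_unitIdx]
    convert hasSum_ite_eq m (b m) using 2 with n
    by_cases hn : n = m
    · simp [hn]
    · simp [hn, Ne.symm hn, unitIdx_injective.eq_iff]
  · rw [firstChaos_of_notMem _ h]
    convert hasSum_zero with n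
    exact if_neg fun h' => h ⟨n, h'.symm⟩

theorem summable_smul_Q (hg : Orthonormal ℝ g) {b : ℕ → ℝ} (hb : Summable fun n => b n ^ 2) :
    Summable fun n => b n • Q hσ hP (g n) := by
  have ho : Orthonormal ℝ fun n => Q hσ hP (g n) := hg.comp_linearIsometry (QIsometry hσ hP)
  refine (ho.orthogonalFamily.summable_iff_norm_sq_summable b).2 ?_
  simpa using hb

theorem chaosExpansion_tsum (hg : Orthonormal ℝ g) {b : ℕ → ℝ}
    (hb : Summable fun n => b n ^ 2) :
    chaosExpansion (fun n => Q hσ hP (g n)) (∑' n, b n • Q hσ hP (g n)) = firstChaos b := by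
  ext α
  have h := hasSum_chaosExpansion (hP := hP) hg (summable_smul_Q (hP := hP) hg hb).hasSum α
  simp_rw [chaosExpansion_smul_Q hg] at h
  exact h.unique (hasSum_firstChaos_single b α)

end Chaos

/-! ### Convergence in the Kondratiev space of distributions -/

/-- The inclusion of `𝒦` in `𝒢_k`, as a continuous linear map. -/
noncomputable def KTest.embCLM (k : ℕ) : KTest →L[ℝ] lp (fun _ : MultiIdx => ℝ) 2 :=
  ⟨KTest.emb k, KTest.continuous_emb k⟩

/-- The map from `ℋ_k`, regarded as `ℓ²`, to the strong dual of `𝒦`. -/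
noncomputable def negToDual (k : ℕ) :
    lp (fun _ : MultiIdx => ℝ) 2 →L[ℝ] StrongDual ℝ KTest :=
  -- Precomposition is continuous for the strong topologies, because a continuous linear map sends
  -- bounded sets to bounded sets.
  (ContinuousLinearMap.precomp ℝ (KTest.embCLM k)).comp (innerSL ℝ)

theorem negToDual_weightedEmb {k : ℕ} (c : KDist) (hc : c.series ∈ HNeg k) :
    negToDual k (weightedEmb (hWeight k) ⟨c.series, hc⟩) = KDist.toDual c := by
  ext f
  exact (hasSum_pairing ⟨c.series, hc⟩ f).tsum_eq.symm

theorem norm_weightedEmb_hWeight {k : ℕ} (c : HNeg k) :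
    ‖weightedEmb (hWeight k) c‖ = negNorm k c.1 := by
  rw [lp.norm_eq_tsum_rpow (by norm_num), negNorm, Real.sqrt_eq_rpow, ENNReal.toReal_ofNat]
  congr 1
  refine tsum_congr fun α => ?_
  change ‖√(hWeight k α : ℝ) * c.1 α‖ ^ (2 : ℝ) = _
  rw [Real.rpow_two, Real.norm_eq_abs, sq_abs, mul_pow, Real.sq_sqrt (NNReal.coe_nonneg _)]

/-- Convergence in the norm of some `ℋ_k` implies strong convergence. -/
theorem KDist.tendsto_of_negNorm {ι : Type*} {l : Filter ι} {c : ι → KDist} {d : KDist} {k : ℕ}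
    (hm : ∀ i, (c i - d).series ∈ HNeg k)
    (h : Tendsto (fun i => negNorm k (c i - d).series) l (𝓝 0)) : Tendsto c l (𝓝 d) := by
  rw [nhds_induced, tendsto_comap_iff, ← tendsto_sub_nhds_zero_iff]
  have h1 : Tendsto (fun i => weightedEmb (hWeight k) ⟨(c i - d).series, hm i⟩) l (𝓝 0) := by
    rw [tendsto_zero_iff_norm_tendsto_zero]
    exact h.congr fun i => (norm_weightedEmb_hWeight ⟨_, hm i⟩).symm
  have h2 := ((negToDual k).continuous.tendsto 0).comp h1
  rw [map_zero] at h2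
  refine h2.congr fun i => ?_
  rw [Function.comp_apply, negToDual_weightedEmb, map_sub]
  rfl

/-! ### Distributions in the first chaos -/

theorem hWeight_unitIdx (k n : ℕ) :
    (hWeight k (unitIdx n) : ℝ) = ((2 * ((n : ℝ) + 1)) ^ k)⁻¹ := by
  rw [hWeight, natWeight_unitIdx]
  push_cast
  rfl

theorem support_weight_firstChaos_subset (k : ℕ) (b : ℕ → ℝ) :
    Function.support (fun α => (hWeight k α : ℝ) * firstChaos b α ^ 2) ⊆ Set.range unitIdx := by
  intro α hα
  by_contra h
  exact hα (by simp [firstChaos_of_notMem b h])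

theorem firstChaos_mem_HNeg {k : ℕ} {b : ℕ → ℝ} :
    firstChaos b ∈ HNeg k ↔ Summable fun n => (hWeight k (unitIdx n) : ℝ) * b n ^ 2 := by
  change Summable (fun α => (hWeight k α : ℝ) * firstChaos b α ^ 2) ↔ _
  rw [← unitIdx_injective.summable_iff fun α hα =>
    Function.notMem_support.1 fun h => hα (support_weight_firstChaos_subset k b h)]
  simp [Function.comp_def, firstChaos_unitIdx]

theorem negNorm_firstChaos (k : ℕ) (b : ℕ → ℝ) :
    negNorm k (firstChaos b) = √(∑' n, (hWeight k (unitIdx n) : ℝ) * b n ^ 2) := by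
  rw [negNorm, ← unitIdx_injective.tsum_eq (support_weight_firstChaos_subset k b)]
  simp [firstChaos_unitIdx]

theorem firstChaos_mem_HNeg_of_summable_sq {b : ℕ → ℝ} (hb : Summable fun n => b n ^ 2) (k : ℕ) :
    firstChaos b ∈ HNeg k := by
  refine hNeg_mono (Nat.zero_le k) (firstChaos_mem_HNeg.2 ?_)
  simpa [hWeight_unitIdx] using hb

theorem summable_hWeight_unitIdx {k : ℕ} (hk : 2 ≤ k) (C : ℝ) :
    Summable fun n => (hWeight k (unitIdx n) : ℝ) * C ^ 2 := by
  refine Summable.mul_right _ ?_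
  have h := (summable_nat_add_iff 1).2 (Real.summable_nat_pow_inv.2 hk)
  refine Summable.of_nonneg_of_le (fun n => NNReal.coe_nonneg _) (fun n => ?_) h
  rw [hWeight_unitIdx]
  push_cast
  gcongr
  linarith [Nat.cast_nonneg (α := ℝ) n]

/-- Dominated convergence for series, used both for partial sums and for difference quotients. -/
theorem tendsto_negNorm_firstChaos {ι : Type*} {l : Filter ι} {k : ℕ} {b : ι → ℕ → ℝ}
    {C : ℕ → ℝ} (hC : Summable fun n => (hWeight k (unitIdx n) : ℝ) * C n ^ 2)
    (hb : ∀ᶠ i in l, ∀ n, |b i n| ≤ C n) (h : ∀ n, Tendsto (fun i => b i n) l (𝓝 0)) :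
    Tendsto (fun i => negNorm k (firstChaos (b i))) l (𝓝 0) := by
  simp_rw [negNorm_firstChaos]
  have h1 := tendsto_tsum_of_dominated_convergence (𝓕 := l)
    (f := fun i n => (hWeight k (unitIdx n) : ℝ) * b i n ^ 2) (g := fun _ => 0) hC
    (fun n => by simpa using ((h n).pow 2).const_mul (hWeight k (unitIdx n) : ℝ)) (by
      filter_upwards [hb] with i hi n
      rw [Real.norm_of_nonneg (by positivity)]
      have := sq_le_sq' (abs_le.1 (hi n)).1 (abs_le.1 (hi n)).2
      gcongr)
  simpa using h1.sqrt

/-- The stochastic distribution with a given formal series. -/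
def KDist.mk (c : FormalSeries) (hc : c ∈ kDistSeries) : KDist := (⟨c, hc⟩ : kDistSeries)

theorem KDist.series_mk (c : FormalSeries) (hc : c ∈ kDistSeries) : (KDist.mk c hc).series = c :=
  rfl

theorem firstChaos_single_mem (n : ℕ) (c : ℝ) : firstChaos (Pi.single n c) ∈ kDistSeries :=
  mem_kDistSeries.2 ⟨0, firstChaos_mem_HNeg_of_summable_sq (summable_of_hasFiniteSupport
    ((Set.finite_singleton n).subset fun m hm => by
      by_contra h
      exact hm (by simp [Pi.single_eq_of_ne (Set.mem_singleton_iff.not.1 h)]))) 0⟩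

/-- The stochastic distribution `c Zₙ`. -/
noncomputable def singleDist (n : ℕ) (c : ℝ) : KDist :=
  KDist.mk (firstChaos (Pi.single n c)) (firstChaos_single_mem n c)

theorem hasSum_singleDist {k : ℕ} {b : ℕ → ℝ} (hb : firstChaos b ∈ HNeg k)
    (hb' : firstChaos b ∈ kDistSeries) :
    HasSum (fun n => singleDist n (b n)) (KDist.mk (firstChaos b) hb') := by
  -- The error of a partial sum is `-b` off `s`: it is dominated by `|b|`, and each of its
  -- coordinates is eventually zero.
  have e : ∀ s : Finset ℕ, (∑ n ∈ s, singleDist n (b n) - KDist.mk (firstChaos b) hb').series =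
      firstChaos (fun n => if n ∈ s then 0 else -b n) := fun s => by
    rw [map_sub, map_sum, KDist.series_mk]
    simp only [singleDist, KDist.series_mk]
    rw [← map_sum, ← map_sub]
    congr 1
    ext n
    simp only [Pi.sub_apply, Finset.sum_apply, Pi.single_apply, Finset.sum_ite_eq]
    split_ifs <;> simp
  have hC := firstChaos_mem_HNeg.1 hb
  refine KDist.tendsto_of_negNorm (k := k) (fun s => ?_) ?_
  · rw [e, firstChaos_mem_HNeg]
    refine Summable.of_nonneg_of_le (fun n => by positivity) (fun n => ?_) hC
    split_ifs
    · rw [zero_pow two_ne_zero, mul_zero]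
      positivity
    · rw [neg_sq]
  · simp_rw [e]
    refine tendsto_negNorm_firstChaos (C := fun n => |b n|) (by simpa using hC)
      (Eventually.of_forall fun s n => ?_) fun n => ?_
    · split_ifs <;> simp
    · refine tendsto_const_nhds.congr' ?_
      filter_upwards [eventually_ge_atTop {n}] with s hs
      exact (if_pos (Finset.singleton_subset_iff.1 hs)).symm

/-! ### The one-dimensional white noise -/

theorem firstChaos_zeta_mem (x : ℝ) {k : ℕ} (hk : 2 ≤ k) :
    firstChaos (fun n => zeta n x) ∈ HNeg k := by
  obtain ⟨C, hC0, hC⟩ := exists_abs_zeta_le |x|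
  rw [firstChaos_mem_HNeg]
  refine Summable.of_nonneg_of_le (fun n => by positivity) (fun n => ?_)
    (summable_hWeight_unitIdx hk C)
  have h := abs_le.1 (hC n x (abs_le.1 le_rfl))
  have := sq_le_sq' h.1 h.2
  gcongr

theorem firstChaos_zetaInt_mem (x : ℝ) (k : ℕ) : firstChaos (fun n => zetaInt n x) ∈ HNeg k :=
  firstChaos_mem_HNeg_of_summable_sq (summable_sq_zetaInt x) k

/-- The white noise `∑ₙ ζₙ(x) Zₙ`. -/
noncomputable def noiseDist (x : ℝ) : KDist :=
  KDist.mk (firstChaos fun n => zeta n x) (mem_kDistSeries.2 ⟨2, firstChaos_zeta_mem x le_rfl⟩)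

/-- The Brownian motion `∑ₙ (∫₀ˣ ζₙ) Zₙ` as a stochastic distribution. -/
noncomputable def brownianDist (x : ℝ) : KDist :=
  KDist.mk (firstChaos fun n => zetaInt n x) (mem_kDistSeries.2 ⟨0, firstChaos_zetaInt_mem x 0⟩)

theorem hasSum_noiseDist (x : ℝ) : HasSum (fun n => singleDist n (zeta n x)) (noiseDist x) :=
  hasSum_singleDist (firstChaos_zeta_mem x le_rfl) _

theorem series_slope_sub (x t a : ℝ) :
    (a • (brownianDist (x + t) - brownianDist x) - noiseDist x).series =
      firstChaos fun n => a * (zetaInt n (x + t) - zetaInt n x) - zeta n x := by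
  rw [map_sub, map_smul, map_sub]
  simp only [brownianDist, noiseDist, KDist.series_mk]
  rw [← map_sub, ← map_smul, ← map_sub]
  rfl

theorem series_slope_sub_mem (x t a : ℝ) {k : ℕ} (hk : 2 ≤ k) :
    (a • (brownianDist (x + t) - brownianDist x) - noiseDist x).series ∈ HNeg k := by
  rw [map_sub, map_smul, map_sub]
  exact sub_mem (Submodule.smul_mem _ _
    (sub_mem (firstChaos_zetaInt_mem _ _) (firstChaos_zetaInt_mem _ _))) (firstChaos_zeta_mem x hk)

/-- Index `2` serves for the strong limit and index `3` for the norm statement. The dominating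
constant is `C` for the average of `ζₙ` plus `C` for `ζₙ(x)`. -/
theorem tendsto_negNorm_slope_sub (x : ℝ) {k : ℕ} (hk : 2 ≤ k) :
    Tendsto (fun t => negNorm k
      (t⁻¹ • (brownianDist (x + t) - brownianDist x) - noiseDist x).series) (𝓝[≠] 0) (𝓝 0) := by
  simp_rw [series_slope_sub]
  -- The radius `|x| + 1` contains every segment from `x` to `x + t` with `|t| ≤ 1`.
  obtain ⟨C, hC0, hC⟩ := exists_abs_zeta_le (|x| + 1)
  refine tendsto_negNorm_firstChaos (C := fun _ => C + C) (summable_hWeight_unitIdx hk _) ?_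
    fun n => ?_
  · have hball : Set.Icc (-1 : ℝ) 1 ∈ 𝓝[≠] (0 : ℝ) :=
      mem_nhdsWithin_of_mem_nhds (Icc_mem_nhds (by norm_num) (by norm_num))
    filter_upwards [hball, self_mem_nhdsWithin] with t ht ht0 n
    have ht0 : t ≠ 0 := ht0
    have hx := abs_le.1 (le_refl |x|)
    refine (abs_sub _ _).trans (add_le_add ?_ (hC n x ⟨by linarith, by linarith⟩))
    rw [abs_mul, abs_inv, zetaInt_sub, inv_mul_le_iff₀ (abs_pos.2 ht0), mul_comm]
    have h := intervalIntegral.norm_integral_le_of_norm_le_const (a := x) (b := x + t)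
      (f := zeta n) (C := C) fun u hu => hC n u <| by
        have h1 := Set.abs_sub_left_of_mem_uIcc (Set.uIoc_subset_uIcc hu)
        rw [add_sub_cancel_left] at h1
        have h2 := abs_le.1 (h1.trans (abs_le.2 ht))
        exact ⟨by linarith, by linarith⟩
    rwa [add_sub_cancel_left] at h
  · have h := hasDerivAt_iff_tendsto_slope_zero.1 (hasDerivAt_zetaInt n x)
    simpa using h.sub_const (zeta n x)

theorem tendsto_slope_brownianDist (x : ℝ) :
    Tendsto (fun t => t⁻¹ • (brownianDist (x + t) - brownianDist x)) (𝓝[≠] 0)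
      (𝓝 (noiseDist x)) :=
  KDist.tendsto_of_negNorm (fun t => series_slope_sub_mem x t t⁻¹ le_rfl)
    (tendsto_negNorm_slope_sub x le_rfl)

/-! ### Invertible hyperbolic numbers -/

theorem Hyp.lam1_inv_mul (h : Hypˣ) : ((h⁻¹ : Hypˣ) : Hyp).lam1 * (h : Hyp).lam1 = 1 := by
  rw [← Hyp.lam1_mul, Units.inv_mul]
  exact add_zero 1

theorem Hyp.lam2_inv_mul (h : Hypˣ) : ((h⁻¹ : Hypˣ) : Hyp).lam2 * (h : Hyp).lam2 = 1 := by
  rw [← Hyp.lam2_mul, Units.inv_mul]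
  exact sub_zero 1

theorem Hyp.lam1_inv (h : Hypˣ) : ((h⁻¹ : Hypˣ) : Hyp).lam1 = (h : Hyp).lam1⁻¹ :=
  eq_inv_of_mul_eq_one_left (Hyp.lam1_inv_mul h)

theorem Hyp.lam2_inv (h : Hypˣ) : ((h⁻¹ : Hypˣ) : Hyp).lam2 = (h : Hyp).lam2⁻¹ :=
  eq_inv_of_mul_eq_one_left (Hyp.lam2_inv_mul h)

theorem Hyp.lam1_add (p q : Hyp) : (p + q).lam1 = p.lam1 + q.lam1 := by
  simp only [Hyp.lam1, QuadraticAlgebra.re_add, QuadraticAlgebra.im_add]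
  ring

theorem Hyp.lam2_add (p q : Hyp) : (p + q).lam2 = p.lam2 + q.lam2 := by
  simp only [Hyp.lam2, QuadraticAlgebra.re_add, QuadraticAlgebra.im_add]
  ring

theorem tendsto_euclNorm_toZeroUnits :
    Tendsto (fun h : Hypˣ => 2 * Hyp.euclNorm (h : Hyp)) toZeroUnits (𝓝 0) := by
  have h : Tendsto (fun h : Hypˣ => Hyp.euclNorm (h : Hyp)) toZeroUnits (𝓝 0) := tendsto_comap
  simpa using h.const_mul 2

theorem Hyp.abs_re_le (p : Hyp) : |p.re| ≤ p.euclNorm :=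
  Real.abs_le_sqrt (by nlinarith [sq_nonneg p.im])

theorem Hyp.abs_im_le (p : Hyp) : |p.im| ≤ p.euclNorm :=
  Real.abs_le_sqrt (by nlinarith [sq_nonneg p.re])

/-- Invertibility keeps the eigenvalue away from `0`, and its absolute value is at most twice the
Euclidean norm. -/
theorem tendsto_lam1_toZeroUnits :
    Tendsto (fun h : Hypˣ => (h : Hyp).lam1) toZeroUnits (𝓝[≠] 0) := by
  refine tendsto_nhdsWithin_iff.2 ⟨squeeze_zero_norm (fun h => ?_) tendsto_euclNorm_toZeroUnits,
    Eventually.of_forall fun h => right_ne_zero_of_mul_eq_one (Hyp.lam1_inv_mul h)⟩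
  refine (abs_add_le _ _).trans ?_
  linarith [Hyp.abs_re_le h, Hyp.abs_im_le h]

theorem tendsto_lam2_toZeroUnits :
    Tendsto (fun h : Hypˣ => (h : Hyp).lam2) toZeroUnits (𝓝[≠] 0) := by
  refine tendsto_nhdsWithin_iff.2 ⟨squeeze_zero_norm (fun h => ?_) tendsto_euclNorm_toZeroUnits,
    Eventually.of_forall fun h => right_ne_zero_of_mul_eq_one (Hyp.lam2_inv_mul h)⟩
  refine (abs_sub _ _).trans ?_
  linarith [Hyp.abs_re_le h, Hyp.abs_im_le h]

/-! ### Sums and limits by components -/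

namespace Idem

variable {M N : Type*} [TopologicalSpace M] [TopologicalSpace N]

theorem hasSum_mk [AddCommGroup M] [AddCommGroup N] {f : ℕ → M} {g : ℕ → N} {a : M} {b : N}
    (hf : HasSum f a) (hg : HasSum g b) : HasSum (fun n => mk (f n) (g n)) (mk a b) :=
  hf.prodMk hg

theorem tendsto_mk {ι : Type*} {l : Filter ι} {f : ι → M} {g : ι → N} {a : M} {b : N}
    (hf : Tendsto f l (𝓝 a)) (hg : Tendsto g l (𝓝 b)) :
    Tendsto (fun i => mk (f i) (g i)) l (𝓝 (mk a b)) :=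
  hf.prodMk_nhds hg

/-- Gives uniqueness of sums, which evaluates the `tsum` defining `hypBrownian`. -/
instance [T2Space M] [T2Space N] : T2Space (Idem M N) := inferInstanceAs (T2Space (M × N))

end Idem

/-- The hyperbolic Brownian motion as a stochastic distribution. -/
noncomputable def hypBrownianDist (p : Hyp) : HypDist :=
  Idem.mk (brownianDist p.lam1) (brownianDist p.lam2)

/-- The hyperbolic white noise. -/
noncomputable def hypNoiseDist (p : Hyp) : HypDist :=
  Idem.mk (noiseDist p.lam1) (noiseDist p.lam2)

theorem diffQuot_hypBrownianDist (p : Hyp) (h : Hypˣ) :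
    diffQuot hypBrownianDist p h = Idem.mk
      ((h : Hyp).lam1⁻¹ • (brownianDist (p.lam1 + (h : Hyp).lam1) - brownianDist p.lam1))
      ((h : Hyp).lam2⁻¹ • (brownianDist (p.lam2 + (h : Hyp).lam2) - brownianDist p.lam2)) := by
  rw [← Hyp.lam1_inv, ← Hyp.lam2_inv, ← Hyp.lam1_add, ← Hyp.lam2_add]
  rfl

theorem diffQuot_sub_plus (p : Hyp) (h : Hypˣ) :
    (diffQuot hypBrownianDist p h - hypNoiseDist p).plus = (h : Hyp).lam1⁻¹ •
      (brownianDist (p.lam1 + (h : Hyp).lam1) - brownianDist p.lam1) - noiseDist p.lam1 := by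
  rw [diffQuot_hypBrownianDist]
  rfl

theorem diffQuot_sub_minus (p : Hyp) (h : Hypˣ) :
    (diffQuot hypBrownianDist p h - hypNoiseDist p).minus = (h : Hyp).lam2⁻¹ •
      (brownianDist (p.lam2 + (h : Hyp).lam2) - brownianDist p.lam2) - noiseDist p.lam2 := by
  rw [diffQuot_hypBrownianDist]
  rfl

end HypNoise

/-! ### The main theorem -/

open HypNoise
theorem mainTheorem2 (σ μ : Measure ℝ) (hσ : IsSpectral σ) (hμ : IsSpectral μ)
    (Pσ Pμ : Measure TempDist) (hPσ : IsWhiteNoiseMeasure σ Pσ) (hPμ : IsWhiteNoiseMeasure μ Pμ)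
    (g : HilbertBasis ℕ ℝ (HSpace hσ)) (g' : HilbertBasis ℕ ℝ (HSpace hμ))
    (Z : ℕ → Lp ℝ 2 Pσ) (hZ : Z = fun n => Q hσ hPσ (g n))
    (W : ℕ → Lp ℝ 2 Pμ) (hW : W = fun n => Q hμ hPμ (g' n)) :
    (∀ p, Summable (brownianTerm Z W p)) ∧
    ∃ (T : Hyp → ℕ → HypDist) (B N : Hyp → HypDist),
      (∀ p n, IsDistOf Z W (noiseTerm Z W p n) (T p n)) ∧
      (∀ p, IsDistOf Z W (hypBrownian Z W p) (B p)) ∧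
      (∀ p, (N p).plus.series = (noiseSeries Z W p).plus ∧
        (N p).minus.series = (noiseSeries Z W p).minus) ∧
      ∀ p,
        HasSum (T p) (N p) ∧
        (N p).plus.series ∈ HNeg 2 ∧ (N p).minus.series ∈ HNeg 2 ∧
        Tendsto (diffQuot B p) toZeroUnits (𝓝 (N p)) ∧
        (∀ h, (diffQuot B p h - N p).plus.series ∈ HNeg 3 ∧
          (diffQuot B p h - N p).minus.series ∈ HNeg 3) ∧
        Tendsto (fun h => negNorm 3 (diffQuot B p h - N p).plus.series)
          toZeroUnits (𝓝 0) ∧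
        Tendsto (fun h => negNorm 3 (diffQuot B p h - N p).minus.series)
          toZeroUnits (𝓝 0) := by
  subst hZ hW
  have hg := g.orthonormal
  have hg' := g'.orthonormal
  have hB : ∀ p, HasSum (brownianTerm (fun n => Q hσ hPσ (g n)) (fun n => Q hμ hPμ (g' n)) p)
      (Idem.mk (∑' n, zetaInt n p.lam1 • Q hσ hPσ (g n))
        (∑' n, zetaInt n p.lam2 • Q hμ hPμ (g' n))) := fun p =>
    Idem.hasSum_mk (summable_smul_Q hg (summable_sq_zetaInt _)).hasSum
      (summable_smul_Q hg' (summable_sq_zetaInt _)).hasSum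
  -- The witnesses are defined by their coefficients alone; the bases enter only when these are
  -- matched with the chaos expansions.
  refine ⟨fun p => (hB p).summable,
    fun p n => Idem.mk (singleDist n (zeta n p.lam1)) (singleDist n (zeta n p.lam2)),
    hypBrownianDist, hypNoiseDist, fun p n => ⟨?_, ?_⟩, fun p => ?_, fun p => ⟨?_, ?_⟩,
    fun p => ⟨?_, ?_, ?_, ?_, fun h => ⟨?_, ?_⟩, ?_, ?_⟩⟩
  · exact (chaosExpansion_smul_Q hg n _).symm
  · exact (chaosExpansion_smul_Q hg' n _).symm
  · rw [hypBrownian, (hB p).tsum_eq]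
    exact ⟨(chaosExpansion_tsum hg (summable_sq_zetaInt _)).symm,
      (chaosExpansion_tsum hg' (summable_sq_zetaInt _)).symm⟩
  · ext α
    change _ = ∑' n, chaosExpansion _ (zeta n p.lam1 • Q hσ hPσ (g n)) α
    simp_rw [chaosExpansion_smul_Q hg]
    exact (hasSum_firstChaos_single (fun n => zeta n p.lam1) α).tsum_eq.symm
  · ext α
    change _ = ∑' n, chaosExpansion _ (zeta n p.lam2 • Q hμ hPμ (g' n)) α
    simp_rw [chaosExpansion_smul_Q hg']
    exact (hasSum_firstChaos_single (fun n => zeta n p.lam2) α).tsum_eq.symm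
  · exact Idem.hasSum_mk (hasSum_noiseDist _) (hasSum_noiseDist _)
  · exact firstChaos_zeta_mem p.lam1 le_rfl
  · exact firstChaos_zeta_mem p.lam2 le_rfl
  · rw [funext (diffQuot_hypBrownianDist p)]
    exact Idem.tendsto_mk ((tendsto_slope_brownianDist p.lam1).comp tendsto_lam1_toZeroUnits)
      ((tendsto_slope_brownianDist p.lam2).comp tendsto_lam2_toZeroUnits)
  · rw [diffQuot_sub_plus]
    exact series_slope_sub_mem _ _ _ (by norm_num)
  · rw [diffQuot_sub_minus]
    exact series_slope_sub_mem _ _ _ (by norm_num)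
  · simp_rw [diffQuot_sub_plus]
    exact (tendsto_negNorm_slope_sub p.lam1 (by norm_num)).comp tendsto_lam1_toZeroUnits
  · simp_rw [diffQuot_sub_minus]
    exact (tendsto_negNorm_slope_sub p.lam2 (by norm_num)).comp tendsto_lam2_toZeroUnits
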